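/- **Polar-like coordinates.** Let $\mathscr H=\mathbb R\times(0,+\infty)$, with closure $\overline{\mathscr H}=\mathbb R\times[0,+\infty)$. Let $\Psi\colon\overline{\mathscr H}\to\mathbb R^2$ define polar-like coordinates: $\Psi(\theta,r)$ is continuous and $2\pi$-periodic in $\theta$; $\Psi^{-1}(0)=\mathbb R\times\{0\}$; the restriction of $\Psi$ to $\mathscr H$ is an orientation-preserving local homeomorphism (local degree $1$ at every point); and $\Psi$ maps $[0,2\pi)\times(0,+\infty)$ bijectively onto $\mathbb R^2\setminus\{0\}$. (Classical clockwise polar coordinates are an example.) **Setting.** Let $U_{\mathrm{in}},U_{\mathrm{out}}\subset\mathbb R^2$ be open bounded sets with $0\in U_{\mathrm{in}}\subset\overline{U_{\mathrm{in}}}\subset U_{\mathrm{out}}$, and let $A=\overline{U_{\mathrm{out}}}\setminus U_{\mathrm{in}}$ be the corresponding generalized annulus. Let $T>0$ and let $\phi\colon[0,T]\times A\to\mathbb R^2$ be continuous with $\phi(0,x)=x$ for every $x\in A$. Assume that no trajectory starting in $A$ hits the origin: $\phi(t,x)\neq0$ for all $t\in[0,T]$, $x\in A$. Write $\phi_T=\phi(T,\cdot)$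 and $f_T(x)=\phi_T(x)-x$. Let $\mathscr A=\Psi^{-1}(A)$, let $\Phi\colon[0,T]\times\mathscr A\to\mathscr H$ be the unique continuous map with $\Phi(0,y)=y$ and $\Psi(\Phi(t,y))=\phi(t,\Psi(y))$ for all $t\in[0,T]$, $y\in\mathscr A$, and let $F_T(y)=\Phi(T,y)-y=(F_T^\theta(y),F_T^r(y))$; it is $2\pi$-periodic in $\theta$. For $E\subseteq A$ let $$\operatorname{rot}(F_T,E)=\Big\{\tfrac1{2\pi}F_T^\theta(y)\;:\;y\in\Psi^{-1}(E)\Big\},\qquad \Sigma(F_T,E)=\mathbb Z\cap\operatorname{conv}\operatorname{rot}(F_T,E).$$ For $i\in\mathbb Z$ let $\nu_i=(2\pi i,0)$; for $x\in A$ we write $F_T(x)=\nu_i$ if $F_T(y)=\nu_i$ for every $y\in\Psi^{-1}(x)$. Let $\deg$ denote Brouwer's degree. For $U\in\{U_{\mathrm{in}},U_{\mathrm{out}}\}$, $\deg(f_T,U,0)$ is defined when $0\notin f_T(\partial U)$; since it depends only on the values on $\partial U\subset A$, it is meaningful although $f_T$ is given on $A$ only (take any continuous extension of $f_T|_{\partial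 U}$ to $\overline U$). **Theorem.** Suppose that the twist condition $$\Sigma(F_T,\partial U_{\mathrm{out}})\cap\Sigma(F_T,\partial U_{\mathrm{in}})=\emptyset$$ holds. Then: * if $0\notin f_T(\partial U_{\mathrm{in}})$ and $\deg(f_T,U_{\mathrm{in}},0)\neq1$, then there is a fixed point $x\in A$ of $\phi_T$ with $F_T(x)=\nu_i$ for some $i\in\Sigma(F_T,\partial U_{\mathrm{in}})$; * if $0\notin f_T(\partial U_{\mathrm{out}})$ and $\deg(f_T,U_{\mathrm{out}},0)\neq1$, then there is a fixed point $x\in A$ of $\phi_T$ with $F_T(x)=\nu_i$ for some $i\in\Sigma(F_T,\partial U_{\mathrm{out}})$. -/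

import Mathlib

open Set Function MeasureTheory
open scoped ContDiff

noncomputable section

/-! ### Brouwer degree in the plane

The plane `ℝ²` is `ℝ × ℝ`. Its norm enters below only through the existence of small
neighbourhoods and small perturbations, so that the choice of the norm is immaterial. -/

/-- The data computing the Brouwer degree `deg(f, U, v)` analytically (Heinz): a smooth map `g` so
close to `f` on `∂U` that the segments from `f x` to `g x`, `x ∈ ∂U`, avoid `v`, and a smooth weight
`η` of total mass one, supported in a ball about `0` so small that its translate by `v` does not
meet `g(∂U)`. Such data exist whenever `U` is open and bounded, `f` is continuous on `∂U` and
`v ∉ f(∂U)`; there are none if `v ∈ f(∂U)`. -/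
structure IsDegreeDatum (f : ℝ × ℝ → ℝ × ℝ) (U : Set (ℝ × ℝ)) (v : ℝ × ℝ)
    (g : ℝ × ℝ → ℝ × ℝ) (η : ℝ × ℝ → ℝ) : Prop where
  smooth : ContDiff ℝ ∞ g
  close : ∀ x ∈ frontier U, dist (g x) (f x) < Metric.infDist v (f '' frontier U)
  weight_smooth : ContDiff ℝ ∞ η
  weight_integral : ∫ z, η z = 1
  weight_support : ∃ ε : ℝ, 0 < ε ∧ tsupport η ⊆ Metric.ball 0 ε ∧
    ∀ x ∈ frontier U, ε ≤ dist (g x) v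

/-- `d` is the value `∫_U η(g(x) - v) det Dg(x) dx` for some data as above. -/
def IsBrouwerDegree (f : ℝ × ℝ → ℝ × ℝ) (U : Set (ℝ × ℝ)) (v : ℝ × ℝ) (d : ℝ) : Prop :=
  ∃ (g : ℝ × ℝ → ℝ × ℝ) (η : ℝ × ℝ → ℝ), IsDegreeDatum f U v g η ∧
    d = ∫ x in U, η (g x - v) * (fderiv ℝ g x).det

open Classical in
/-- The Brouwer degree `deg(f, U, v)`, for `U` open and bounded, `f` continuous on `∂U` and
`v ∉ f(∂U)` (the value is `0` if `v ∈ f(∂U)`, where the degree is not defined). The integral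
does not depend on `g` and `η` (and it is an integer: for a regular value `v` of `g` it is the sum
of the signs of `det Dg` over `U ∩ g⁻¹(v)`). As is well known, the degree depends on the values
of `f` on `∂U` only, so `f` need not be specified inside `U`. -/
def brouwerDegree (f : ℝ × ℝ → ℝ × ℝ) (U : Set (ℝ × ℝ)) (v : ℝ × ℝ) : ℝ :=
  if h : ∃ d, IsBrouwerDegree f U v d then h.choose else 0

/-! ### Polar-like coordinates -/

/-- The open half-plane `ℝ × (0, ∞)` of the pairs `(θ, r)`. -/
def openHalfPlane : Set (ℝ × ℝ) := {y | 0 < y.2}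

/-- The closed half-plane `ℝ × [0, ∞)`. -/
def closedHalfPlane : Set (ℝ × ℝ) := {y | 0 ≤ y.2}

/-- `Ψ`, of which only the restriction to the closed half-plane is used, defines polar-like
coordinates on the plane. Preservation of the orientation means, as usual for a local
homeomorphism, that the local degree is `1` at every point of the open half-plane. -/
structure IsPolarLike (Ψ : ℝ × ℝ → ℝ × ℝ) : Prop where
  periodic : ∀ θ r : ℝ, 0 ≤ r → Ψ (θ + 2 * Real.pi, r) = Ψ (θ, r)
  origin : ∀ y ∈ closedHalfPlane, Ψ y = 0 ↔ y.2 = 0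
  continuousOn : ContinuousOn Ψ closedHalfPlane
  isLocalHomeomorphOn : IsLocalHomeomorphOn Ψ openHalfPlane
  bijOn : BijOn Ψ (Ico 0 (2 * Real.pi) ×ˢ Ioi 0) {0}ᶜ
  orientation : ∀ V : Set (ℝ × ℝ), IsOpen V → Bornology.IsBounded V →
    closure V ⊆ openHalfPlane → InjOn Ψ (closure V) → ∀ y ∈ V, brouwerDegree Ψ V (Ψ y) = 1

/-- The set `Ψ⁻¹(E)` in the closed half-plane. -/
def polarPreimage (Ψ : ℝ × ℝ → ℝ × ℝ) (E : Set (ℝ × ℝ)) : Set (ℝ × ℝ) :=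
  {y | y ∈ closedHalfPlane ∧ Ψ y ∈ E}

/-! ### Annuli and evolution maps -/

/-- The sets `Uin`, `Uout` define a generalized annulus. -/
structure IsAnnulusPair (Uin Uout : Set (ℝ × ℝ)) : Prop where
  isOpen_in : IsOpen Uin
  isOpen_out : IsOpen Uout
  isBounded_in : Bornology.IsBounded Uin
  isBounded_out : Bornology.IsBounded Uout
  zero_mem : (0 : ℝ × ℝ) ∈ Uin
  closure_subset : closure Uin ⊆ Uout

/-- The generalized annulus `A`, closed in the plane. -/
def genAnnulus (Uin Uout : Set (ℝ × ℝ)) : Set (ℝ × ℝ) := closure Uout \ Uin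

/-- `φ : [0, T] × Ω → ℝ²` is a continuous evolution map: `φ(0, ·)` is the identity. -/
structure IsEvolutionMap (T : ℝ) (Ω : Set (ℝ × ℝ)) (φ : ℝ → ℝ × ℝ → ℝ × ℝ) : Prop where
  continuousOn : ContinuousOn (uncurry φ) (Icc 0 T ×ˢ Ω)
  initial : ∀ x ∈ Ω, φ 0 x = x

/-- The set `𝒩` of the points of `Ω` whose trajectory hits the origin. -/
def nullSet (T : ℝ) (Ω : Set (ℝ × ℝ)) (φ : ℝ → ℝ × ℝ → ℝ × ℝ) : Set (ℝ × ℝ) :=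
  {x | x ∈ Ω ∧ ∃ t ∈ Icc 0 T, φ t x = 0}

/-- The displacement `f_T(x) = φ(T, x) - x`. -/
def displacement (T : ℝ) (φ : ℝ → ℝ × ℝ → ℝ × ℝ) (x : ℝ × ℝ) : ℝ × ℝ := φ T x - x

/-- `Φ : [0, T] × Ψ⁻¹(E) → ℝ × (0, ∞)` is the continuous lift of `φ` in polar-like coordinates
that starts at the identity. -/
structure IsPolarLift (Ψ : ℝ × ℝ → ℝ × ℝ) (T : ℝ) (E : Set (ℝ × ℝ)) (φ : ℝ → ℝ × ℝ → ℝ × ℝ)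
    (Φ : ℝ → ℝ × ℝ → ℝ × ℝ) : Prop where
  continuousOn : ContinuousOn (uncurry Φ) (Icc 0 T ×ˢ polarPreimage Ψ E)
  mapsTo : ∀ t ∈ Icc 0 T, ∀ y ∈ polarPreimage Ψ E, Φ t y ∈ openHalfPlane
  initial : ∀ y ∈ polarPreimage Ψ E, Φ 0 y = y
  lifts : ∀ t ∈ Icc 0 T, ∀ y ∈ polarPreimage Ψ E, Ψ (Φ t y) = φ t (Ψ y)

open Classical in
/-- The lift `Φ`. It exists, and its values on `[0, T] × Ψ⁻¹(E)` are unique, by the homotopy lifting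
property, when no trajectory starting in `E` hits the origin. -/
def polarLift (Ψ : ℝ × ℝ → ℝ × ℝ) (T : ℝ) (E : Set (ℝ × ℝ)) (φ : ℝ → ℝ × ℝ → ℝ × ℝ) :
    ℝ → ℝ × ℝ → ℝ × ℝ :=
  if h : ∃ Φ, IsPolarLift Ψ T E φ Φ then h.choose else fun _ y => y

/-- The lifted displacement `F_T(y) = Φ(T, y) - y`, for `y ∈ Ψ⁻¹(E)`. -/
def polarDisplacement (Ψ : ℝ × ℝ → ℝ × ℝ) (T : ℝ) (E : Set (ℝ × ℝ)) (φ : ℝ → ℝ × ℝ → ℝ × ℝ)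
    (y : ℝ × ℝ) : ℝ × ℝ :=
  polarLift Ψ T E φ T y - y

/-- The set `rot(F, E)` of the rotations `F^θ(y) / 2π`, `Ψ(y) ∈ E`. -/
def rotationSet (Ψ : ℝ × ℝ → ℝ × ℝ) (F : ℝ × ℝ → ℝ × ℝ) (E : Set (ℝ × ℝ)) : Set ℝ :=
  (fun y => (1 / (2 * Real.pi)) * (F y).1) '' polarPreimage Ψ E

/-- The set `Σ(F, E)` of the integers in the convex hull of `rot(F, E)`. -/
def rotationIntegers (Ψ : ℝ × ℝ → ℝ × ℝ) (F : ℝ × ℝ → ℝ × ℝ) (E : Set (ℝ × ℝ)) : Set ℤ :=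
  {i | (i : ℝ) ∈ convexHull ℝ (rotationSet Ψ F E)}

/-- `F(x) = ν_i = (2πi, 0)`, where `F` is evaluated at any `y ∈ Ψ⁻¹(x)`. -/
def HasIntegerRotation (Ψ : ℝ × ℝ → ℝ × ℝ) (F : ℝ × ℝ → ℝ × ℝ) (x : ℝ × ℝ) (i : ℤ) : Prop :=
  ∀ y ∈ polarPreimage Ψ {x}, F y = (2 * Real.pi * i, 0)

end

/-! Suppose that no fixed point has its rotation in `Σ(F_T, D)`, where `D` is one of the two
boundaries. The theorem follows once the degree of the displacement on the corresponding set is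
shown to be one.

In polar-like coordinates `φ_T` sends the point `(θ, r)` over `x` to `(θ + 2πu(x), R(x))`, with `u`
the rotation function. Truncate `u` to an interval barely larger than its range on `D`, adding no
integer. By the twist condition the truncated function maps the other boundary into a gap `(k, k +
1)` between consecutive integers, so Tietze's theorem extends it beyond that boundary with values in
the gap. Multiply `R`, also extended, by a cutoff that is one on `A` and zero on a set `Z`. The
resulting `F(x) = Ψ(θ + 2πc(x), R(x)χ(x)) - x` agrees with `f_T` on `D` and is `-x` on `Z`. A zero
off the origin forces `c(x)` to be an integer: impossible in the gap, and on `A` it would be one of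
the excluded fixed points. This is `exists_displacement_extension`.

For `U_in` the extension lives on the complement of `U_in` and is `-x` near infinity; for `U_out` it
lives on the closure of `U_out` and is `-x` near the origin. Either way the degree is that of `-id`,
which is one in the plane (`IsBrouwerDegree.eq_one_of_extension_compl` and
`IsBrouwerDegree.eq_one_of_extension_closure`). These two rest on the invariance of the Jacobian
integral under compactly supported changes of the map, which holds because the integrand is a
divergence. -/

open Filter Topology

/-! ### Jacobian integrals, smooth selections and degree data -/

/-- A compactly supported smooth function on the plane is the first partial derivative of a smooth
function. -/
theorem exists_contDiff_fderiv_fst_eq {η : ℝ × ℝ → ℝ} (hη : ContDiff ℝ ∞ η)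
    (hc : HasCompactSupport η) :
    ∃ P : ℝ × ℝ → ℝ, ContDiff ℝ ∞ P ∧ ∀ z, fderiv ℝ P z (1, 0) = η z := by
  -- Convolving with the Heaviside function in the first variable integrates `η` from `-∞`; the
  -- convolution theorem with parameters gives joint smoothness.
  set f : ℝ → ℝ := (Ioi (0 : ℝ)).indicator fun _ => 1 with hf
  have hloc : LocallyIntegrable f volume := (locallyIntegrable_const 1).indicator measurableSet_Ioi
  set Q : ℝ × ℝ → ℝ := fun q =>
    MeasureTheory.convolution f (fun x => η (x, q.1)) (ContinuousLinearMap.mul ℝ ℝ) volume q.2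
  have hQs : ContDiff ℝ ∞ Q := by
    have hk : IsCompact (Prod.fst '' tsupport η) := IsCompact.image hc continuous_fst
    have := contDiffOn_convolution_right_with_param (μ := volume) (n := (⊤ : ℕ∞))
      (f := f) (g := fun p x => η (x, p)) (ContinuousLinearMap.mul ℝ ℝ) isOpen_univ hk ?_ hloc
      (hη.comp (contDiff_snd.prodMk contDiff_fst)).contDiffOn
    · rw [← contDiffOn_univ, ← univ_prod_univ]
      exact this
    · intro p x _ hx
      by_contra h
      exact hx ⟨(x, p), subset_tsupport _ h, rfl⟩
  have hPs : ContDiff ℝ ∞ (fun z : ℝ × ℝ => Q (z.2, z.1)) :=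
    hQs.comp (contDiff_snd.prodMk contDiff_fst)
  refine ⟨_, hPs, fun z => ?_⟩
  have hline : ∀ s : ℝ, HasDerivAt (fun s : ℝ => ((s, z.2) : ℝ × ℝ)) (1, 0) s := fun s =>
    (hasDerivAt_id s).prodMk (hasDerivAt_const s z.2)
  have hsec : ContDiff ℝ ∞ (fun s : ℝ => η (s, z.2)) := hη.comp (contDiff_id.prodMk contDiff_const)
  have hemb : Topology.IsClosedEmbedding (fun s : ℝ => ((s, z.2) : ℝ × ℝ)) :=
    (Isometry.of_dist_eq fun a b => by simp [Prod.dist_eq]).isClosedEmbedding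
  have hsecc : HasCompactSupport (fun s : ℝ => η (s, z.2)) := hc.comp_isClosedEmbedding hemb
  have h1 : HasDerivAt (fun s : ℝ => Q (z.2, s))
      (fderiv ℝ (fun z : ℝ × ℝ => Q (z.2, z.1)) z (1, 0)) z.1 :=
    (hPs.differentiable (by simp) z).hasFDerivAt.comp_hasDerivAt (f := fun s : ℝ => (s, z.2)) z.1
      (hline z.1)
  have h2 := hsecc.hasDerivAt_convolution_right (ContinuousLinearMap.mul ℝ ℝ) (μ := volume) hloc
    (hsec.of_le (by exact_mod_cast le_top)) z.1
  rw [h1.unique h2, MeasureTheory.convolution_def]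
  have h3 : ∀ t : ℝ, ContinuousLinearMap.mul ℝ ℝ (f t) (deriv (fun s : ℝ => η (s, z.2)) (z.1 - t)) =
      (Ioi (0 : ℝ)).indicator (fun t => deriv (fun s : ℝ => η (s, z.2)) (z.1 - t)) t := by
    intro t
    by_cases ht : t ∈ Ioi (0 : ℝ) <;> simp [hf, ht]
  simp_rw [h3]
  rw [integral_indicator measurableSet_Ioi]
  have hcurve : ∀ t : ℝ, HasDerivAt (fun t : ℝ => -η (z.1 - t, z.2))
      (deriv (fun s : ℝ => η (s, z.2)) (z.1 - t)) t := by
    intro t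
    have := (hsec.differentiable (by simp) (z.1 - t)).hasDerivAt.comp_const_sub z.1 t
    simpa using this.fun_neg
  have hemb' : Topology.IsClosedEmbedding (fun t : ℝ => z.1 - t) :=
    (Isometry.of_dist_eq fun a b => by
      rw [Real.dist_eq, Real.dist_eq, sub_sub_sub_cancel_left, abs_sub_comm]).isClosedEmbedding
  have hint : IntegrableOn (fun t : ℝ => deriv (fun s : ℝ => η (s, z.2)) (z.1 - t)) (Ioi 0) := by
    apply Integrable.integrableOn
    apply Continuous.integrable_of_hasCompactSupport
    · exact (hsec.continuous_deriv (by simp)).comp (by fun_prop)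
    · exact hsecc.deriv.comp_isClosedEmbedding hemb'
  have htend : Tendsto (fun t : ℝ => -η (z.1 - t, z.2)) atTop (𝓝 0) := by
    have h3 : Tendsto (fun t : ℝ => η (z.1 - t, z.2)) atTop (𝓝 0) :=
      (hsecc.comp_isClosedEmbedding hemb').is_zero_at_infty.mono_left atTop_le_cocompact
    simpa using h3.neg
  have := integral_Ioi_of_hasDerivAt_of_tendsto (hcurve 0).continuousAt.continuousWithinAt
    (fun s _ => hcurve s) hint htend
  simpa using this

theorem ContinuousLinearMap.det_prod_real (L : ℝ × ℝ →L[ℝ] ℝ × ℝ) :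
    L.det = (L (1, 0)).1 * (L (0, 1)).2 - (L (0, 1)).1 * (L (1, 0)).2 := by
  rw [ContinuousLinearMap.det, ← LinearMap.det_toMatrix (Module.Basis.finTwoProd ℝ),
    Matrix.det_fin_two]
  simp [LinearMap.toMatrix_apply]

theorem integral_fderiv_apply_eq_zero {A : ℝ × ℝ → ℝ} (hA : ContDiff ℝ 1 A)
    (hc : HasCompactSupport A) (v : ℝ × ℝ) : ∫ x, fderiv ℝ A x v = 0 := by
  have h1 : Integrable (fun x => fderiv ℝ A x v) :=
    Continuous.integrable_of_hasCompactSupport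
      ((hA.continuous_fderiv one_ne_zero).clm_apply continuous_const)
      ((hc.fderiv ℝ).comp_left (g := fun L : ℝ × ℝ →L[ℝ] ℝ => L v) rfl)
  have h2 : Integrable A := hA.continuous.integrable_of_hasCompactSupport hc
  have := integral_mul_fderiv_eq_neg_fderiv_mul_of_integrable (μ := volume)
    (f := fun _ : ℝ × ℝ => (1 : ℝ)) (g := A) (v := v) (by simp) (by simpa using h1)
    (by simpa using h2) (by simp) (fun x _ => hA.differentiable one_ne_zero x)
  simpa using this

/-- The Jacobian integrand `(∂₁P)(g) det Dg` is a divergence. -/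
theorem mul_det_fderiv_eq_divergence {P : ℝ × ℝ → ℝ} {g : ℝ × ℝ → ℝ × ℝ} (hP : ContDiff ℝ ∞ P)
    (hg : ContDiff ℝ ∞ g) (x : ℝ × ℝ) :
    fderiv ℝ P (g x) (1, 0) * (fderiv ℝ g x).det =
      fderiv ℝ (fun y => P (g y) * (fderiv ℝ g y (0, 1)).2) x (1, 0) -
      fderiv ℝ (fun y => P (g y) * (fderiv ℝ g y (1, 0)).2) x (0, 1) := by
  have hdg : HasFDerivAt g (fderiv ℝ g x) x := (hg.differentiable (by simp) x).hasFDerivAt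
  have hPg : HasFDerivAt (fun y => P (g y)) ((fderiv ℝ P (g x)).comp (fderiv ℝ g x)) x :=
    (hP.differentiable (by simp) (g x)).hasFDerivAt.comp x hdg
  have hd2 : HasFDerivAt (fderiv ℝ g) (fderiv ℝ (fderiv ℝ g) x) x :=
    ((hg.fderiv_right (m := 1) (by norm_cast)).differentiable
      (by simp) x).hasFDerivAt
  have hv : ∀ v : ℝ × ℝ, HasFDerivAt (fun y => (fderiv ℝ g y v).2)
      ((ContinuousLinearMap.snd ℝ ℝ ℝ).comp ((fderiv ℝ (fderiv ℝ g) x).flip v)) x := by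
    intro v
    have := hd2.clm_apply (hasFDerivAt_const v x)
    simpa using this.snd
  -- The mixed second derivatives cancel in the divergence, and so do the terms with the second
  -- partial derivative of `P`.
  have hsymm : fderiv ℝ (fderiv ℝ g) x (1, 0) (0, 1) = fderiv ℝ (fderiv ℝ g) x (0, 1) (1, 0) :=
    (hg.contDiffAt.isSymmSndFDerivAt (by simp; norm_cast)).eq _ _
  rw [(hPg.fun_mul (hv _)).fderiv, (hPg.fun_mul (hv _)).fderiv, ContinuousLinearMap.det_prod_real]
  have hsplit : ∀ w : ℝ × ℝ, fderiv ℝ P (g x) w =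
      w.1 * fderiv ℝ P (g x) (1, 0) + w.2 * fderiv ℝ P (g x) (0, 1) := by
    intro w
    have : w = w.1 • ((1, 0) : ℝ × ℝ) + w.2 • ((0, 1) : ℝ × ℝ) := by ext <;> simp
    conv_lhs => rw [this]
    simp only [map_add, map_smul, smul_eq_mul]
  simp only [add_apply, smul_apply,
    ContinuousLinearMap.comp_apply, ContinuousLinearMap.flip_apply,
    ContinuousLinearMap.coe_snd', smul_eq_mul, hsymm]
  rw [hsplit (fderiv ℝ g x (1, 0)), hsplit (fderiv ℝ g x (0, 1))]
  ring

/-- Smooth maps that agree off a compact set have the same Jacobian integral. -/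
theorem integral_mul_det_fderiv_sub_eq_zero {η : ℝ × ℝ → ℝ} (hη : ContDiff ℝ ∞ η)
    (hc : HasCompactSupport η) {g h : ℝ × ℝ → ℝ × ℝ} (hg : ContDiff ℝ ∞ g) (hh : ContDiff ℝ ∞ h)
    {K : Set (ℝ × ℝ)} (hK : IsCompact K) (hgh : ∀ x ∉ K, g x = h x) :
    ∫ x, (η (g x) * (fderiv ℝ g x).det - η (h x) * (fderiv ℝ h x).det) = 0 := by
  obtain ⟨P, hP, hPη⟩ := exists_contDiff_fderiv_fst_eq hη hc
  -- `P` need not have compact support, but the fluxes of `g` and `h` agree off `K`, so their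
  -- difference does; only this difference is integrated.
  have key : ∀ v : ℝ × ℝ, ContDiff ℝ 1 (fun y => P (g y) * (fderiv ℝ g y v).2 -
        P (h y) * (fderiv ℝ h y v).2) ∧
      HasCompactSupport (fun y => P (g y) * (fderiv ℝ g y v).2 -
        P (h y) * (fderiv ℝ h y v).2) ∧ ∀ f : ℝ × ℝ → ℝ × ℝ, ContDiff ℝ ∞ f →
        ContDiff ℝ 1 (fun y => P (f y) * (fderiv ℝ f y v).2) := by
    intro v
    have h3 : ∀ f : ℝ × ℝ → ℝ × ℝ, ContDiff ℝ ∞ f →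
        ContDiff ℝ 1 (fun y => P (f y) * (fderiv ℝ f y v).2) := by
      intro f hf
      have h1 : ContDiff ℝ 1 P := hP.of_le (by exact_mod_cast le_top)
      have h2 : ContDiff ℝ 1 f := hf.of_le (by exact_mod_cast le_top)
      have h4 : ContDiff ℝ 1 (fderiv ℝ f) := hf.fderiv_right (by norm_cast)
      exact (h1.comp h2).mul (h4.clm_apply contDiff_const).snd
    refine ⟨(h3 g hg).sub (h3 h hh), HasCompactSupport.intro hK fun x hx => ?_, h3⟩
    have : g =ᶠ[𝓝 x] h := by
      filter_upwards [hK.isClosed.isOpen_compl.mem_nhds hx] with y hy using hgh y hy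
    rw [this.fderiv_eq, hgh x hx, sub_self]
  have hpt : ∀ x, η (g x) * (fderiv ℝ g x).det - η (h x) * (fderiv ℝ h x).det =
      fderiv ℝ (fun y => P (g y) * (fderiv ℝ g y (0, 1)).2 -
        P (h y) * (fderiv ℝ h y (0, 1)).2) x (1, 0) -
      fderiv ℝ (fun y => P (g y) * (fderiv ℝ g y (1, 0)).2 -
        P (h y) * (fderiv ℝ h y (1, 0)).2) x (0, 1) := by
    intro x
    have hd : ∀ v f, ContDiff ℝ ∞ f →
        DifferentiableAt ℝ (fun y => P (f y) * (fderiv ℝ f y v).2) x := fun v f hf =>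
      ((key v).2.2 f hf).differentiable one_ne_zero x
    rw [← hPη, ← hPη, mul_det_fderiv_eq_divergence hP hg, mul_det_fderiv_eq_divergence hP hh,
      fderiv_fun_sub (hd _ g hg) (hd _ h hh), fderiv_fun_sub (hd _ g hg) (hd _ h hh)]
    simp only [sub_apply]
    ring
  have hint : ∀ v w, Integrable (fun x => fderiv ℝ (fun y => P (g y) * (fderiv ℝ g y v).2 -
        P (h y) * (fderiv ℝ h y v).2) x w) := fun v w =>
    Continuous.integrable_of_hasCompactSupport
      (((key v).1.continuous_fderiv one_ne_zero).clm_apply continuous_const)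
      (((key v).2.1.fderiv ℝ).comp_left (g := fun L : ℝ × ℝ →L[ℝ] ℝ => L w) rfl)
  simp_rw [hpt]
  rw [integral_sub (hint _ _) (hint _ _), integral_fderiv_apply_eq_zero (key _).1 (key _).2.1,
    integral_fderiv_apply_eq_zero (key _).1 (key _).2.1, sub_zero]

/-- A smooth partition of unity averages the local choices, and convexity keeps the average in `t
x`. The sets need not vary continuously: singletons prescribe values on a region, balls or
half-lines impose open conditions elsewhere. -/
theorem exists_contDiff_forall_mem_convex_of_local {F : Type*} [NormedAddCommGroup F]
    [NormedSpace ℝ F] {t : ℝ × ℝ → Set F} (ht : ∀ x, Convex ℝ (t x))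
    (hloc : ∀ x, ∃ g : ℝ × ℝ → F, ContDiff ℝ ∞ g ∧ ∀ᶠ y in 𝓝 x, g y ∈ t y) :
    ∃ g : ℝ × ℝ → F, ContDiff ℝ ∞ g ∧ ∀ x, g x ∈ t x := by
  obtain ⟨g, hg⟩ := exists_contMDiffMap_forall_mem_convex_of_local
    (modelWithCornersSelf ℝ (ℝ × ℝ)) (n := (⊤ : ℕ∞)) ht fun x => by
      obtain ⟨g, hg, hgt⟩ := hloc x
      exact ⟨_, hgt, g, hg.contMDiff.contMDiffOn, fun y hy => hy⟩
  exact ⟨g, g.contMDiff.contDiff, hg⟩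

theorem convex_setOf_lt_mul (a b : ℝ) : Convex ℝ {l : ℝ | a < l * b} :=
  convex_halfSpace_gt (IsLinearMap.mk (fun x y => by ring) fun c x => by simp [mul_assoc]) a

/-- This excludes the default value `0` in `brouwerDegree`, which differs from one. -/
theorem exists_isBrouwerDegree {f : ℝ × ℝ → ℝ × ℝ} {U : Set (ℝ × ℝ)}
    (hb : Bornology.IsBounded U) (hne : (frontier U).Nonempty) (hf : ContinuousOn f (frontier U))
    {v : ℝ × ℝ} (hv : v ∉ f '' frontier U) : ∃ d, IsBrouwerDegree f U v d := by
  have hcF : IsCompact (frontier U) :=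
    Metric.isCompact_of_isClosed_isBounded isClosed_frontier (hb.closure.subset frontier_subset_closure)
  have hd : 0 < Metric.infDist v (f '' frontier U) :=
    ((hcF.image_of_continuousOn hf).isClosed.notMem_iff_infDist_pos (hne.image f)).1 hv
  obtain ⟨g, hg, hgt⟩ := exists_contDiff_forall_mem_convex_of_local
    (t := fun x => {z | x ∈ frontier U → dist z (f x) < Metric.infDist v (f '' frontier U)})
    (fun x => by
      by_cases hx : x ∈ frontier U
      · simpa [hx, Metric.ball] using convex_ball (f x) (Metric.infDist v (f '' frontier U))
      · simpa [hx] using convex_univ)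
    (fun x => by
      refine ⟨fun _ => f x, contDiff_const, ?_⟩
      by_cases hx : x ∈ frontier U
      · have : Tendsto (fun y => dist (f x) (f y)) (𝓝[frontier U] x) (𝓝 0) := by
          simpa using (tendsto_const_nhds (x := f x)).dist (hf x hx)
        exact eventually_nhdsWithin_iff.1 (this.eventually_lt_const hd)
      · filter_upwards [isClosed_frontier.isOpen_compl.mem_nhds hx] with y hy h
        exact absurd h hy)
  obtain ⟨x₀, hx₀, hmin⟩ := hcF.exists_isMinOn hne
    (f := fun x => dist (g x) v) (hg.continuous.dist continuous_const).continuousOn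
  have hε : 0 < dist (g x₀) v := by
    refine dist_pos.2 fun h => ?_
    have h1 := hgt x₀ hx₀
    rw [h] at h1
    exact absurd (Metric.infDist_le_dist_of_mem (mem_image_of_mem f hx₀)) (not_le.2 h1)
  let B : ContDiffBump (0 : ℝ × ℝ) := ⟨dist (g x₀) v / 4, dist (g x₀) v / 2, by linarith, by linarith⟩
  refine ⟨_, g, B.normed volume, ⟨hg, fun x hx => hgt x hx, B.contDiff_normed, B.integral_normed,
    dist (g x₀) v, hε, ?_, fun x hx => hmin hx⟩, rfl⟩
  rw [B.tsupport_normed_eq]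
  exact Metric.closedBall_subset_ball (by change _ / 2 < _; linarith)

/-! ### Two criteria for degree one -/

theorem fderiv_neg_smul_id_det (c : ℝ) (x : ℝ × ℝ) :
    (fderiv ℝ (fun y : ℝ × ℝ => -(c • y)) x).det = c ^ 2 := by
  have : HasFDerivAt (fun y : ℝ × ℝ => -(c • y)) (-(c • ContinuousLinearMap.id ℝ (ℝ × ℝ))) x :=
    ((hasFDerivAt_id x).const_smul c).neg
  rw [this.fderiv, ContinuousLinearMap.det_prod_real]
  simp
  ring

/-- The model computation, a linear change of variables: in dimension two `-c • id` preserves the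
orientation. -/
theorem integral_neg_smul_mul_det {η : ℝ × ℝ → ℝ} (hη : ∫ z, η z = 1) {c : ℝ} (hc : c ≠ 0) :
    ∫ x, η (-(c • x)) * (fderiv ℝ (fun y : ℝ × ℝ => -(c • y)) x).det = 1 := by
  simp_rw [fderiv_neg_smul_id_det]
  have := Measure.integral_comp_smul (volume : Measure (ℝ × ℝ)) η (-c)
  simp only [neg_smul] at this
  rw [integral_mul_const, this, hη]
  simp [Module.finrank_prod, abs_inv]
  field_simp

/-- The compact support of `η` leaves room inside the open ball of radius `ε`. The strict inequality
on the boundary is then an open condition, as smooth selection requires. -/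
theorem IsDegreeDatum.exists_radius {f g : ℝ × ℝ → ℝ × ℝ} {U : Set (ℝ × ℝ)} {η : ℝ × ℝ → ℝ}
    (h : IsDegreeDatum f U 0 g η) : ∃ r, 0 < r ∧ (∀ z, r < ‖z‖ → η z = 0) ∧
      HasCompactSupport η ∧ ∀ x ∈ frontier U, r < ‖g x‖ := by
  obtain ⟨ε, hε, hsub, hle⟩ := h.weight_support
  obtain ⟨r, hr, hrs⟩ := exists_pos_lt_subset_ball hε (isClosed_tsupport η) hsub
  refine ⟨r, hr.1, fun z hz => ?_, ?_, fun x hx => ?_⟩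
  · by_contra hne
    have := hrs (subset_tsupport η hne)
    rw [mem_ball_zero_iff] at this
    exact absurd this (not_lt.2 hz.le)
  · exact HasCompactSupport.of_support_subset_isCompact (isCompact_closedBall 0 r)
      ((subset_tsupport η).trans (hrs.trans Metric.ball_subset_closedBall))
  · have := hle x hx
    rw [dist_zero_right] at this
    exact hr.2.trans_le this

theorem IsDegreeDatum.dist_lt_norm {f g : ℝ × ℝ → ℝ × ℝ} {U : Set (ℝ × ℝ)} {η : ℝ × ℝ → ℝ}
    (h : IsDegreeDatum f U 0 g η) {x : ℝ × ℝ} (hx : x ∈ frontier U) :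
    dist (g x) (f x) < ‖f x‖ := by
  refine (h.close x hx).trans_le ((Metric.infDist_le_dist_of_mem (mem_image_of_mem f hx)).trans ?_)
  rw [dist_zero_left]

theorem ContinuousWithinAt.eventually_dist_lt_norm {f g : ℝ × ℝ → ℝ × ℝ} {s : Set (ℝ × ℝ)}
    {x : ℝ × ℝ} (hf : ContinuousWithinAt f s x) (hg : Continuous g)
    (h : dist (g x) (f x) < ‖f x‖) : ∀ᶠ y in 𝓝 x, y ∈ s → dist (g y) (f y) < ‖f y‖ :=
  eventually_nhdsWithin_iff.1
    ((hg.continuousWithinAt.dist hf).eventually_lt hf.norm h)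

theorem zero_notMem_ball_norm (z : ℝ × ℝ) : (0 : ℝ × ℝ) ∉ Metric.ball z ‖z‖ := by
  simp [dist_zero_left]

/-- The hypothesis is linear in `l` and so defines a convex set of multipliers; the conclusion in
general does not. -/
theorem lt_norm_smul_of_lt_mul {r l : ℝ} {z : ℝ × ℝ} (h : r < l * ‖z‖) : r < ‖l • z‖ := by
  rw [norm_smul]
  exact h.trans_le (mul_le_mul_of_nonneg_right (le_abs_self l) (norm_nonneg z))

/-- If the boundary values extend to the complement of `U` without zeros and with value `-x` near
infinity, then the degree is one. -/
theorem IsBrouwerDegree.eq_one_of_extension_compl {f F : ℝ × ℝ → ℝ × ℝ} {U : Set (ℝ × ℝ)}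
    (hU : IsOpen U) (hb : Bornology.IsBounded U) (hF : ContinuousOn F Uᶜ)
    (hfF : EqOn F f (frontier U)) (hne : ∀ x ∈ Uᶜ, F x ≠ 0) {M : ℝ} (hM : ∀ x, M ≤ ‖x‖ → F x = -x)
    {d : ℝ} (hd : IsBrouwerDegree f U 0 d) : d = 1 := by
  classical
  obtain ⟨g, η, hdat, rfl⟩ := hd
  obtain ⟨r, hr, hηr, hηc, hgr⟩ := hdat.exists_radius
  obtain ⟨N, hN⟩ : ∃ N, closure U ⊆ Metric.ball 0 N ∧ M ≤ N ∧ r < N := by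
    obtain ⟨N, hN⟩ := hb.closure.subset_ball 0
    refine ⟨max N (max M (r + 1)), hN.trans (Metric.ball_subset_ball (le_max_left _ _)), ?_, ?_⟩
    · exact (le_max_left _ _).trans (le_max_right _ _)
    · exact (lt_add_one r).trans_le ((le_max_right _ _).trans (le_max_right _ _))
  obtain ⟨hUN, hMN, hrN⟩ := hN
  have hlt : ∀ x ∈ closure U, ‖x‖ < N := fun x hx => mem_ball_zero_iff.1 (hUN hx)
  have hfr : ∀ x ∈ closure U, x ∉ U → x ∈ frontier U := fun x hx hxU => by
    rw [hU.frontier_eq]; exact ⟨hx, hxU⟩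
  have hcompl : ∀ y ∉ closure U, y ∈ Uᶜ := fun y hy h => hy (subset_closure h)
  -- A smooth map equal to `g` on the closure of `U` and to `-x` far away. In between, the ball
  -- about `F x` of radius `‖F x‖` is a convex target that avoids zero.
  obtain ⟨G₁, hG₁, hG₁t⟩ := exists_contDiff_forall_mem_convex_of_local
    (t := fun x => if x ∈ closure U then {g x} else if N ≤ ‖x‖ then {-x} else
      Metric.ball (F x) ‖F x‖)
    (fun x => by
      split_ifs
      exacts [convex_singleton _, convex_singleton _, convex_ball _ _])
    (fun x => by
      by_cases hx : x ∈ closure U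
      · refine ⟨g, hdat.smooth, ?_⟩
        by_cases hxU : x ∈ U
        · filter_upwards [hU.mem_nhds hxU] with y hy
          simp [subset_closure hy]
        · have hxf := hfr x hx hxU
          -- At a boundary point `g` is strictly closer to `F` than `‖F x‖`, so `g` itself remains
          -- an admissible choice nearby.
          have h1 := (hF x hxU).eventually_dist_lt_norm hdat.smooth.continuous
            (by rw [hfF hxf]; exact hdat.dist_lt_norm hxf)
          filter_upwards [h1, (isOpen_lt continuous_norm continuous_const).mem_nhds (hlt x hx)]
            with y hy hyN
          by_cases hyc : y ∈ closure U
          · simp [hyc]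
          · simpa [hyc, not_le.2 hyN] using hy (hcompl y hyc)
      · have hx' : ∀ᶠ y in 𝓝 x, y ∉ closure U := isClosed_closure.isOpen_compl.mem_nhds hx
        by_cases hxN : N ≤ ‖x‖
        · refine ⟨fun y => -y, contDiff_neg, ?_⟩
          have h1 := (hF x (hcompl x hx)).eventually_dist_lt_norm (g := fun y => -y) continuous_neg
            (by simpa [hM x (hMN.trans hxN)] using hne x (hcompl x hx))
          filter_upwards [hx', h1] with y hy hy1
          by_cases hyN : N ≤ ‖y‖
          · simp [hy, hyN]
          · simpa [hy, hyN] using hy1 (hcompl y hy)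
        · refine ⟨fun _ => F x, contDiff_const, ?_⟩
          have h1 := (hF x (hcompl x hx)).eventually_dist_lt_norm (g := fun _ => F x)
            continuous_const (by simpa using hne x (hcompl x hx))
          filter_upwards [hx', h1, (isOpen_lt continuous_norm continuous_const).mem_nhds
            (not_le.1 hxN)] with y hy hy1 hyN
          simpa [hy, not_le.2 hyN] using hy1 (hcompl y hy))
  have hG₁U : ∀ x ∈ closure U, G₁ x = g x := fun x hx => by simpa [hx] using hG₁t x
  have hG₁N : ∀ x, N ≤ ‖x‖ → G₁ x = -x := fun x hx => by
    have hxc : x ∉ closure U := fun h => absurd (hlt x h) (not_lt.2 hx)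
    simpa [hxc, hx] using hG₁t x
  have hG₁0 : ∀ x ∉ closure U, 0 < ‖G₁ x‖ := fun x hx => by
    rw [norm_pos_iff]
    by_cases hxN : N ≤ ‖x‖
    · rw [hG₁N x hxN, ← hM x (hMN.trans hxN)]
      exact hne x (hcompl x hx)
    · intro h0
      have := hG₁t x
      simp only [hx, hxN, if_false, h0] at this
      exact zero_notMem_ball_norm _ this
  -- Being nonzero is not enough: a smooth rescaling pushes the values off `U` beyond the radius
  -- `r`, where the weight vanishes. It is trivial where `G₁` is already prescribed.
  obtain ⟨l, hl, hlt'⟩ := exists_contDiff_forall_mem_convex_of_local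
    (t := fun x => if x ∈ closure U then {1} else if N ≤ ‖x‖ then {1} else
      {l : ℝ | r < l * ‖G₁ x‖})
    (fun x => by
      split_ifs
      exacts [convex_singleton _, convex_singleton _, convex_setOf_lt_mul _ _])
    (fun x => by
      have hev : ∀ c : ℝ, r < c * ‖G₁ x‖ → ∀ᶠ y in 𝓝 x, r < c * ‖G₁ y‖ := fun c hc =>
        (isOpen_lt continuous_const (continuous_const.mul hG₁.continuous.norm)).mem_nhds hc
      by_cases hx : x ∈ closure U ∨ N ≤ ‖x‖
      · refine ⟨fun _ => 1, contDiff_const, ?_⟩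
        by_cases hxU : x ∈ U
        · filter_upwards [hU.mem_nhds hxU] with y hy
          simp [subset_closure hy]
        · have h1 : r < 1 * ‖G₁ x‖ := by
            rw [one_mul]
            rcases hx with hx | hx
            · rw [hG₁U x hx]; exact hgr x (hfr x hx hxU)
            · rw [hG₁N x hx, norm_neg]; exact hrN.trans_le hx
          filter_upwards [hev 1 h1] with y hy
          split_ifs
          exacts [rfl, rfl, hy]
      · push Not at hx
        have h0 := hG₁0 x hx.1
        refine ⟨fun _ => (r + 1) / ‖G₁ x‖, contDiff_const, ?_⟩
        filter_upwards [hev ((r + 1) / ‖G₁ x‖) (by rw [div_mul_cancel₀ _ h0.ne']; linarith),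
          isClosed_closure.isOpen_compl.mem_nhds hx.1,
          (isOpen_lt continuous_norm continuous_const).mem_nhds hx.2] with y hy hyc hyN
        have hyc' : y ∉ closure U := hyc
        simpa [hyc', not_le.2 hyN] using hy)
  set G : ℝ × ℝ → ℝ × ℝ := fun x => l x • G₁ x with hGdef
  have hG : ContDiff ℝ ∞ G := hl.smul hG₁
  have hGU : ∀ x ∈ closure U, G x = g x := fun x hx => by
    have : l x = 1 := by simpa [hx] using hlt' x
    simp [hGdef, this, hG₁U x hx]
  have hGN : ∀ x, N ≤ ‖x‖ → G x = -((1 : ℝ) • x) := fun x hx => by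
    have hxc : x ∉ closure U := fun h => absurd (hlt x h) (not_lt.2 hx)
    have : l x = 1 := by simpa [hxc, hx] using hlt' x
    simp [hGdef, this, hG₁N x hx]
  have hGr : ∀ x ∉ U, r < ‖G x‖ := fun x hx => by
    by_cases hxc : x ∈ closure U
    · rw [hGU x hxc]; exact hgr x (hfr x hxc hx)
    · by_cases hxN : N ≤ ‖x‖
      · rw [hGN x hxN, one_smul, norm_neg]; exact hrN.trans_le hxN
      · exact lt_norm_smul_of_lt_mul (by simpa [hxc, hxN] using hlt' x)
  -- `G` and `-x` differ only in a ball, so the integral of `G` over the plane is one; the weight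
  -- confines it to `U`, where `G = g`.
  have hA := integral_mul_det_fderiv_sub_eq_zero hdat.weight_smooth hηc hG
    (h := fun x : ℝ × ℝ => -((1 : ℝ) • x)) (by fun_prop) (isCompact_closedBall (0 : ℝ × ℝ) N)
    (fun x hx => hGN x (by
      rw [mem_closedBall_zero_iff, not_le] at hx; exact hx.le))
  have hcont : ∀ h : ℝ × ℝ → ℝ × ℝ, ContDiff ℝ ∞ h →
      Continuous (fun x => η (h x) * (fderiv ℝ h x).det) := fun h hh =>
    (hdat.weight_smooth.continuous.comp hh.continuous).mul
      (ContinuousLinearMap.continuous_det.comp (hh.continuous_fderiv (by simp)))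
  have hi1 : Integrable (fun x => η (G x) * (fderiv ℝ G x).det) :=
    (hcont G hG).integrable_of_hasCompactSupport
      (HasCompactSupport.intro (Metric.isCompact_of_isClosed_isBounded isClosed_closure hb.closure)
        fun x hx => by rw [hηr _ (hGr x (hcompl x hx)), zero_mul])
  have hi2 : Integrable (fun x => η (-((1 : ℝ) • x)) *
      (fderiv ℝ (fun y : ℝ × ℝ => -((1 : ℝ) • y)) x).det) :=
    (hcont _ (by fun_prop)).integrable_of_hasCompactSupport
      (HasCompactSupport.intro (isCompact_closedBall (0 : ℝ × ℝ) r) fun x hx => by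
        rw [hηr, zero_mul]
        rw [mem_closedBall_zero_iff, not_le] at hx
        simpa using hx)
  rw [integral_sub hi1 hi2, integral_neg_smul_mul_det hdat.weight_integral one_ne_zero,
    sub_eq_zero] at hA
  have hGs : ∫ x in U, η (G x) * (fderiv ℝ G x).det = ∫ x, η (G x) * (fderiv ℝ G x).det :=
    setIntegral_eq_integral_of_forall_compl_eq_zero
      (fun x hx => by rw [hηr _ (hGr x hx), zero_mul])
  rw [← hA, ← hGs]
  refine setIntegral_congr_fun hU.measurableSet fun x hx => ?_
  have : G =ᶠ[𝓝 x] g := by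
    filter_upwards [hU.mem_nhds hx] with y hy using hGU y (subset_closure hy)
  simp only [sub_zero, this.fderiv_eq, this.eq_of_nhds]

/-- If the boundary values extend to the closure of `U` with the origin as the only zero and with
value `-x` near the origin, then the degree is one. -/
theorem IsBrouwerDegree.eq_one_of_extension_closure {f F : ℝ × ℝ → ℝ × ℝ} {U : Set (ℝ × ℝ)}
    (hU : IsOpen U) (hb : Bornology.IsBounded U) (hF : ContinuousOn F (closure U))
    (hfF : EqOn F f (frontier U)) (hne : ∀ x ∈ closure U, x ≠ 0 → F x ≠ 0) {δ : ℝ} (hδ : 0 < δ)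
    (hδU : Metric.closedBall 0 δ ⊆ U) (hFδ : ∀ x, ‖x‖ ≤ δ → F x = -x)
    {d : ℝ} (hd : IsBrouwerDegree f U 0 d) : d = 1 := by
  classical
  obtain ⟨g, η, hdat, rfl⟩ := hd
  obtain ⟨r, hr, hηr, hηc, hgr⟩ := hdat.exists_radius
  have hmem : ∀ x, ‖x‖ ≤ δ → x ∈ U := fun x hx => hδU (mem_closedBall_zero_iff.2 hx)
  have hfr : ∀ x ∈ closure U, x ∉ U → x ∈ frontier U := fun x hx hxU => by
    rw [hU.frontier_eq]; exact ⟨hx, hxU⟩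
  have hpos : ∀ x : ℝ × ℝ, δ ≤ ‖x‖ → x ≠ 0 := fun x hx => norm_pos_iff.1 (hδ.trans_le hx)
  have hgt : ∀ x, x ∉ U → δ < ‖x‖ := fun x hx => by
    by_contra h; exact hx (hmem x (not_lt.1 h))
  have hev_lt : ∀ x : ℝ × ℝ, ‖x‖ < δ → ∀ᶠ y : ℝ × ℝ in 𝓝 x, ‖y‖ < δ := fun x hx =>
    (isOpen_lt continuous_norm continuous_const).mem_nhds hx
  have hev_gt : ∀ x : ℝ × ℝ, δ < ‖x‖ → ∀ᶠ y : ℝ × ℝ in 𝓝 x, δ < ‖y‖ := fun x hx =>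
    (isOpen_lt continuous_const continuous_norm).mem_nhds hx
  have hev_ext : ∀ x, x ∉ closure U → ∀ᶠ y in 𝓝 x, y ∉ U := fun x hx => by
    filter_upwards [isClosed_closure.isOpen_compl.mem_nhds hx] with y hy h
    exact hy (subset_closure h)
  obtain ⟨G₁, hG₁, hG₁t⟩ := exists_contDiff_forall_mem_convex_of_local
    (t := fun x => if x ∈ U then (if ‖x‖ ≤ δ then {-x} else Metric.ball (F x) ‖F x‖) else {g x})
    (fun x => by
      split_ifs
      exacts [convex_singleton _, convex_ball _ _, convex_singleton _])
    (fun x => by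
      by_cases hx : x ∈ U
      · have hxc := subset_closure hx
        by_cases hxδ : ‖x‖ ≤ δ
        · refine ⟨fun y => -y, contDiff_neg, ?_⟩
          rcases hxδ.lt_or_eq with hlt | heq
          · filter_upwards [hev_lt x hlt] with y hy
            simp [hmem y hy.le, hy.le]
          · have h1 := (hF x hxc).eventually_dist_lt_norm (g := fun y => -y) continuous_neg
              (by simpa [hFδ x hxδ] using hpos x heq.ge)
            filter_upwards [h1, hU.mem_nhds hx] with y hy hyU
            by_cases hyδ : ‖y‖ ≤ δ
            · simp [hyU, hyδ]
            · simpa [hyU, hyδ] using hy (subset_closure hyU)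
        · refine ⟨fun _ => F x, contDiff_const, ?_⟩
          have h1 := (hF x hxc).eventually_dist_lt_norm (g := fun _ => F x) continuous_const
            (by simpa using hne x hxc (hpos x (not_le.1 hxδ).le))
          filter_upwards [h1, hU.mem_nhds hx, hev_gt x (not_le.1 hxδ)] with y hy hyU hyδ
          simpa [hyU, not_le.2 hyδ] using hy (subset_closure hyU)
      · refine ⟨g, hdat.smooth, ?_⟩
        by_cases hxc : x ∈ closure U
        · have hxf := hfr x hxc hx
          have h1 := (hF x hxc).eventually_dist_lt_norm hdat.smooth.continuous
            (by rw [hfF hxf]; exact hdat.dist_lt_norm hxf)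
          filter_upwards [h1, hev_gt x (hgt x hx)] with y hy hyδ
          by_cases hyU : y ∈ U
          · simpa [hyU, not_le.2 hyδ] using hy (subset_closure hyU)
          · simp [hyU]
        · filter_upwards [hev_ext x hxc] with y hy
          simp [hy])
  have hG₁U : ∀ x ∉ U, G₁ x = g x := fun x hx => by simpa [hx] using hG₁t x
  have hG₁δ : ∀ x, ‖x‖ ≤ δ → G₁ x = -x := fun x hx => by simpa [hmem x hx, hx] using hG₁t x
  have hG₁0 : ∀ x ∈ U, δ < ‖x‖ → 0 < ‖G₁ x‖ := fun x hx hxδ => by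
    rw [norm_pos_iff]
    intro h0
    have := hG₁t x
    simp only [hx, not_le.2 hxδ, if_false, if_true, h0] at this
    exact zero_notMem_ball_norm _ this
  -- With this factor the map `-c • x` has norm `r + 1` on the sphere `‖x‖ = δ`, so the weight sees
  -- it only inside.
  set c : ℝ := (r + 1) / δ with hc
  have hcpos : 0 < c := by positivity
  have hcδ : c * δ = r + 1 := div_mul_cancel₀ _ hδ.ne'
  obtain ⟨l, hl, hlt⟩ := exists_contDiff_forall_mem_convex_of_local
    (t := fun x => if x ∈ U then (if ‖x‖ ≤ δ then {c} else {l : ℝ | r < l * ‖G₁ x‖}) else {1})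
    (fun x => by
      split_ifs
      exacts [convex_singleton _, convex_setOf_lt_mul _ _, convex_singleton _])
    (fun x => by
      have hev : ∀ c : ℝ, r < c * ‖G₁ x‖ → ∀ᶠ y in 𝓝 x, r < c * ‖G₁ y‖ := fun c hc =>
        (isOpen_lt continuous_const (continuous_const.mul hG₁.continuous.norm)).mem_nhds hc
      by_cases hx : x ∈ U
      · by_cases hxδ : ‖x‖ ≤ δ
        · refine ⟨fun _ => c, contDiff_const, ?_⟩
          rcases hxδ.lt_or_eq with hlt | heq
          · filter_upwards [hev_lt x hlt] with y hy
            simp [hmem y hy.le, hy.le]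
          · filter_upwards [hev c (by rw [hG₁δ x hxδ, norm_neg, heq, hcδ]; linarith),
              hU.mem_nhds hx] with y hy hyU
            by_cases hyδ : ‖y‖ ≤ δ
            · simp [hyU, hyδ]
            · simpa [hyU, hyδ] using hy
        · have h0 := hG₁0 x hx (not_le.1 hxδ)
          refine ⟨fun _ => (r + 1) / ‖G₁ x‖, contDiff_const, ?_⟩
          filter_upwards [hev ((r + 1) / ‖G₁ x‖) (by rw [div_mul_cancel₀ _ h0.ne']; linarith),
            hU.mem_nhds hx, hev_gt x (not_le.1 hxδ)] with y hy hyU hyδ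
          simpa [hyU, not_le.2 hyδ] using hy
      · refine ⟨fun _ => 1, contDiff_const, ?_⟩
        by_cases hxc : x ∈ closure U
        · filter_upwards [hev 1 (by rw [one_mul, hG₁U x hx]; exact hgr x (hfr x hxc hx)),
            hev_gt x (hgt x hx)] with y hy hyδ
          by_cases hyU : y ∈ U
          · simpa [hyU, not_le.2 hyδ] using hy
          · simp [hyU]
        · filter_upwards [hev_ext x hxc] with y hy
          simp [hy])
  set G : ℝ × ℝ → ℝ × ℝ := fun x => l x • G₁ x with hGdef
  have hG : ContDiff ℝ ∞ G := hl.smul hG₁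
  have hGU : ∀ x ∉ U, G x = g x := fun x hx => by
    have : l x = 1 := by simpa [hx] using hlt x
    simp [hGdef, this, hG₁U x hx]
  have hGδ : ∀ x, ‖x‖ ≤ δ → G x = -(c • x) := fun x hx => by
    have : l x = c := by simpa [hmem x hx, hx] using hlt x
    simp [hGdef, this, hG₁δ x hx]
  have hcr : ∀ x : ℝ × ℝ, δ ≤ ‖x‖ → r < ‖-(c • x)‖ := fun x hx => by
    rw [norm_neg, norm_smul, Real.norm_of_nonneg hcpos.le]
    have := mul_le_mul_of_nonneg_left hx hcpos.le
    linarith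
  have hGr : ∀ x ∈ closure U, δ ≤ ‖x‖ → r < ‖G x‖ := fun x hxc hxδ => by
    by_cases hx : x ∈ U
    · by_cases hxδ' : ‖x‖ ≤ δ
      · rw [hGδ x hxδ']; exact hcr x hxδ
      · exact lt_norm_smul_of_lt_mul (by simpa [hx, hxδ'] using hlt x)
    · rw [hGU x hx]; exact hgr x (hfr x hxc hx)
  -- Here the maps compared are `G` and `g`, equal off `U`. The integral of `G` over `U` then
  -- reduces to that of `-c • x` on the small ball.
  have hA := integral_mul_det_fderiv_sub_eq_zero hdat.weight_smooth hηc hG hdat.smooth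
    (Metric.isCompact_of_isClosed_isBounded isClosed_closure hb.closure)
    (fun x hx => hGU x fun h => hx (subset_closure h))
  have hi : ∀ h : ℝ × ℝ → ℝ × ℝ, ContDiff ℝ ∞ h →
      IntegrableOn (fun x => η (h x) * (fderiv ℝ h x).det) U := fun h hh =>
    (((hdat.weight_smooth.continuous.comp hh.continuous).mul
      (ContinuousLinearMap.continuous_det.comp
        (hh.continuous_fderiv (by simp)))).continuousOn.integrableOn_compact
      (Metric.isCompact_of_isClosed_isBounded isClosed_closure hb.closure)).mono_set subset_closure
  rw [← setIntegral_eq_integral_of_forall_compl_eq_zero (s := U), integral_sub (hi G hG)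
    (hi g hdat.smooth), sub_eq_zero] at hA
  · have hlin : ∫ x in U, η (-(c • x)) * (fderiv ℝ (fun y : ℝ × ℝ => -(c • y)) x).det = 1 := by
      rw [← integral_neg_smul_mul_det hdat.weight_integral hcpos.ne']
      exact setIntegral_eq_integral_of_forall_compl_eq_zero
        (fun x hx => by rw [hηr _ (hcr x (hgt x hx).le), zero_mul])
    simp only [sub_zero]
    rw [← hA, ← hlin]
    refine setIntegral_congr_fun hU.measurableSet fun x hx => ?_
    rcases lt_or_ge ‖x‖ δ with hlt' | hge
    · have : G =ᶠ[𝓝 x] fun y => -(c • y) := by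
        filter_upwards [hev_lt x hlt'] with y hy using hGδ y hy.le
      simp only [this.fderiv_eq, this.eq_of_nhds]
    · rw [hηr _ (hGr x (subset_closure hx) hge), hηr _ (hcr x hge), zero_mul, zero_mul]
  -- On the boundary of `U`, possibly of positive measure, the derivatives of `G` and `g` are not
  -- compared: the weight vanishes there.
  · intro x hx
    by_cases hxc : x ∈ closure U
    · rw [hGU x hx, hηr _ (hgr x (hfr x hxc hx)), zero_mul, zero_mul, sub_zero]
    · have : G =ᶠ[𝓝 x] g := by
        filter_upwards [hev_ext x hxc] with y hy using hGU y hy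
      rw [this.fderiv_eq, this.eq_of_nhds, sub_self]

/-- The degree is a chosen value, so it suffices that every admissible datum gives `a`; independence
of the datum is not needed in general. -/
theorem brouwerDegree_eq_of_forall {f : ℝ × ℝ → ℝ × ℝ} {U : Set (ℝ × ℝ)} {v : ℝ × ℝ} {a : ℝ}
    (hex : ∃ d, IsBrouwerDegree f U v d) (h : ∀ d, IsBrouwerDegree f U v d → d = a) :
    brouwerDegree f U v = a := by
  rw [brouwerDegree, dif_pos hex]
  exact h _ hex.choose_spec

/-! ### Polar-like coordinates as a covering map -/

theorem isOpen_openHalfPlane : IsOpen openHalfPlane :=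
  isOpen_lt continuous_const continuous_snd

theorem openHalfPlane_subset_closedHalfPlane : openHalfPlane ⊆ closedHalfPlane :=
  fun y (hy : 0 < y.2) => show 0 ≤ y.2 from hy.le

theorem exists_add_two_pi_mul_int_mem_Ico (θ : ℝ) : ∃ n : ℤ, θ + 2 * Real.pi * n ∈ Ico 0 (2 * Real.pi) := by
  obtain ⟨n, hn, -⟩ := existsUnique_add_zsmul_mem_Ico Real.two_pi_pos θ 0
  exact ⟨n, by simpa [mul_comm] using hn⟩

namespace IsPolarLike

variable {Ψ : ℝ × ℝ → ℝ × ℝ}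

theorem apply_add_two_pi_mul_int (hΨ : IsPolarLike Ψ) {r : ℝ} (hr : 0 ≤ r) (θ : ℝ) (n : ℤ) :
    Ψ (θ + 2 * Real.pi * n, r) = Ψ (θ, r) := by
  have h : Function.Periodic (fun θ => Ψ (θ, r)) (2 * Real.pi) := fun θ => hΨ.periodic θ r hr
  have := h.int_mul n θ
  rwa [mul_comm (n : ℝ)] at this

theorem apply_ne_zero (hΨ : IsPolarLike Ψ) {y : ℝ × ℝ} (hy : y ∈ openHalfPlane) : Ψ y ≠ 0 :=
  fun h => (ne_of_gt (show 0 < y.2 from hy))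
    ((hΨ.origin y (openHalfPlane_subset_closedHalfPlane hy)).1 h)

/-- Shift both angles into `[0, 2π)`, where `Ψ` is injective. -/
theorem eq_add_of_apply_eq (hΨ : IsPolarLike Ψ) {y z : ℝ × ℝ} (hy : y ∈ openHalfPlane)
    (hz : z ∈ openHalfPlane) (h : Ψ z = Ψ y) : ∃ n : ℤ, z = y + (2 * Real.pi * n, 0) := by
  obtain ⟨m, hm⟩ := exists_add_two_pi_mul_int_mem_Ico y.1
  obtain ⟨n, hn⟩ := exists_add_two_pi_mul_int_mem_Ico z.1
  have := hΨ.bijOn.injOn (x₁ := (z.1 + 2 * Real.pi * n, z.2)) (x₂ := (y.1 + 2 * Real.pi * m, y.2))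
    ⟨hn, hz⟩ ⟨hm, hy⟩ (by
      rw [hΨ.apply_add_two_pi_mul_int (le_of_lt hz), hΨ.apply_add_two_pi_mul_int (le_of_lt hy)]
      exact h)
  rw [Prod.mk.injEq] at this
  refine ⟨m - n, Prod.ext ?_ ?_⟩
  · push_cast; simp only [Prod.fst_add]; linarith [this.1]
  · simpa using this.2

theorem exists_apply_eq (hΨ : IsPolarLike Ψ) {x : ℝ × ℝ} (hx : x ≠ 0) :
    ∃ y ∈ openHalfPlane, Ψ y = x := by
  obtain ⟨y, hy, rfl⟩ := hΨ.bijOn.surjOn (show x ∈ ({0}ᶜ : Set (ℝ × ℝ)) from hx)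
  exact ⟨y, hy.2, rfl⟩

theorem polarPreimage_subset (hΨ : IsPolarLike Ψ) {E : Set (ℝ × ℝ)} (hE : (0 : ℝ × ℝ) ∉ E) :
    polarPreimage Ψ E ⊆ openHalfPlane := fun y hy =>
  lt_of_le_of_ne hy.1 fun h => hE ((hΨ.origin y hy.1).2 h.symm ▸ hy.2)

theorem map_nhds_eq (hΨ : IsPolarLike Ψ) {y : ℝ × ℝ} (hy : y ∈ openHalfPlane) :
    map Ψ (𝓝 y) = 𝓝 (Ψ y) :=
  hΨ.isLocalHomeomorphOn.map_nhds_eq hy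

/-- A function on the plane is continuous where its expression in polar-like coordinates is. -/
theorem continuousOn_of_comp (hΨ : IsPolarLike Ψ) {Z : Type*} [TopologicalSpace Z]
    {S : Set (ℝ × ℝ)} (hS : (0 : ℝ × ℝ) ∉ S) {w W : ℝ × ℝ → Z}
    (hW : ContinuousOn W (polarPreimage Ψ S)) (hwW : ∀ y ∈ polarPreimage Ψ S, w (Ψ y) = W y) :
    ContinuousOn w S := by
  intro x hx
  obtain ⟨y, hy, rfl⟩ := hΨ.exists_apply_eq (x := x) fun h => hS (h ▸ hx)
  have hmem : y ∈ polarPreimage Ψ S := ⟨openHalfPlane_subset_closedHalfPlane hy, hx⟩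
  have hnear : closedHalfPlane ∈ 𝓝 y :=
    mem_of_superset (isOpen_openHalfPlane.mem_nhds hy) openHalfPlane_subset_closedHalfPlane
  have hnhds : 𝓝[polarPreimage Ψ S] y = 𝓝 y ⊓ 𝓟 (Ψ ⁻¹' S) := by
    change 𝓝[closedHalfPlane ∩ Ψ ⁻¹' S] y = _
    rw [nhdsWithin_inter_of_mem (mem_nhdsWithin_of_mem_nhds hnear)]
    rfl
  -- A local homeomorphism carries neighbourhood filters onto neighbourhood filters, so the limit
  -- can be computed upstairs.
  rw [ContinuousWithinAt, nhdsWithin, ← hΨ.map_nhds_eq hy, ← Filter.map_inf_principal_preimage,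
    tendsto_map'_iff, ← hnhds, hwW y hmem]
  exact (hW y hmem).congr' (eventually_nhdsWithin_of_forall fun z hz => (hwW z hz).symm)

end IsPolarLike

/-- The deck transformations `(θ, r) ↦ (θ + 2πn, r)` of the open half-plane. -/
@[reducible] noncomputable def deckAction : AddAction ℤ openHalfPlane where
  vadd n y := ⟨(y.1.1 + 2 * Real.pi * n, y.1.2), y.2⟩
  zero_vadd y := Subtype.ext (Prod.ext (by change y.1.1 + 2 * Real.pi * ((0 : ℤ) : ℝ) = _; simp) rfl)
  add_vadd m n y := Subtype.ext (Prod.ext (by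
    change y.1.1 + 2 * Real.pi * ((m + n : ℤ) : ℝ) = y.1.1 + 2 * Real.pi * n + 2 * Real.pi * m
    push_cast; ring) rfl)

/-- `Ψ` is an open continuous surjection whose fibres are the orbits of a properly discontinuous
action of `ℤ`. -/
theorem IsPolarLike.isCoveringMap {Ψ : ℝ × ℝ → ℝ × ℝ} (hΨ : IsPolarLike Ψ) :
    IsCoveringMap (fun y : openHalfPlane =>
      (⟨Ψ y, hΨ.apply_ne_zero y.2⟩ : ({0}ᶜ : Set (ℝ × ℝ)))) := by
  let := deckAction
  have hvadd : ∀ (n : ℤ) (y : openHalfPlane),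
      (n +ᵥ y).1 = (y.1.1 + 2 * Real.pi * n, y.1.2) := fun _ _ => rfl
  set p : openHalfPlane → ({0}ᶜ : Set (ℝ × ℝ)) := fun y => ⟨Ψ y, hΨ.apply_ne_zero y.2⟩ with hp
  have hcont : Continuous p := by
    refine Continuous.subtype_mk ?_ _
    exact (hΨ.continuousOn.mono openHalfPlane_subset_closedHalfPlane).domRestrict
  have hopen : IsOpenMap p := by
    have hq : IsOpenMap (fun y : openHalfPlane => Ψ y) := by
      rw [isOpenMap_iff_nhds_le]
      intro y
      rw [← hΨ.map_nhds_eq y.2, ← isOpen_openHalfPlane.isOpenEmbedding_subtypeVal.map_nhds_eq y,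
        Filter.map_map]
      exact le_rfl
    intro V hV
    refine ⟨_, hq V hV, ?_⟩
    ext x
    simp [hp, Subtype.ext_iff]
  have hsurj : Surjective p := fun x => by
    obtain ⟨y, hy, hyx⟩ := hΨ.exists_apply_eq x.2
    exact ⟨⟨y, hy⟩, Subtype.ext hyx⟩
  have : IsAddQuotientCoveringMap p ℤ :=
    { toIsQuotientMap := hopen.isQuotientMap hcont hsurj
      continuous_const_vadd := fun n => by
        refine Continuous.subtype_mk (f := fun y : openHalfPlane =>
          (y.1.1 + 2 * Real.pi * n, y.1.2)) (by fun_prop) _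
      apply_eq_iff_mem_orbit := fun {y z} => by
        rw [AddAction.mem_orbit_iff]
        constructor
        · intro h
          obtain ⟨n, hn⟩ := hΨ.eq_add_of_apply_eq z.2 y.2 (congrArg Subtype.val h)
          exact ⟨n, Subtype.ext (by rw [hvadd, hn]; ext <;> simp)⟩
        · rintro ⟨n, rfl⟩
          exact Subtype.ext (hΨ.apply_add_two_pi_mul_int (le_of_lt z.2) _ n)
      disjoint := fun e => by
        -- An open strip of width `2π` is disjoint from its nontrivial translates.
        refine ⟨{y | dist y.1.1 e.1.1 < Real.pi},
          (isOpen_lt (by fun_prop) continuous_const).mem_nhds (by simp [Real.pi_pos]), ?_⟩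
        rintro n ⟨_, ⟨y, hy, rfl⟩, hy'⟩
        simp only [mem_ofPred_eq, hvadd] at hy hy'
        have h1 : dist (y.1.1 + 2 * Real.pi * n) y.1.1 < 2 * Real.pi := by
          have := dist_triangle_right (y.1.1 + 2 * Real.pi * n) y.1.1 e.1.1
          linarith
        rw [Real.dist_eq, add_sub_cancel_left, abs_mul, abs_of_pos Real.two_pi_pos] at h1
        have h2 : |(n : ℝ)| < 1 := by
          by_contra h
          have := mul_le_mul_of_nonneg_left (not_lt.1 h) Real.two_pi_pos.le
          linarith
        exact Int.abs_lt_one_iff.1 (by exact_mod_cast h2) }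
  exact this.isCoveringMap

/-- Homotopy lifting through the covering `Ψ`, with time rescaled to the unit interval and the
inclusion as initial lift. -/
theorem exists_isPolarLift {Ψ : ℝ × ℝ → ℝ × ℝ} (hΨ : IsPolarLike Ψ) {T : ℝ} (hT : 0 < T)
    {E : Set (ℝ × ℝ)} {φ : ℝ → ℝ × ℝ → ℝ × ℝ} (hφ : IsEvolutionMap T E φ)
    (hnull : ∀ t ∈ Icc 0 T, ∀ x ∈ E, φ t x ≠ 0) : ∃ Φ, IsPolarLift Ψ T E φ Φ := by
  classical
  have hE : (0 : ℝ × ℝ) ∉ E := fun h =>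
    hnull 0 ⟨le_rfl, hT.le⟩ 0 h (hφ.initial 0 h)
  have hsub := hΨ.polarPreimage_subset hE
  have hmul : ∀ s : unitInterval, T * (s : ℝ) ∈ Icc 0 T := fun s =>
    ⟨mul_nonneg hT.le s.2.1, mul_le_of_le_one_right hT.le s.2.2⟩
  have hpair : ∀ q : unitInterval × polarPreimage Ψ E, (T * (q.1 : ℝ), Ψ q.2) ∈ Icc 0 T ×ˢ E :=
    fun q => ⟨hmul q.1, q.2.2.2⟩
  have hΨc : Continuous (fun y : polarPreimage Ψ E => Ψ y) :=
    (hΨ.continuousOn.mono fun y hy => hy.1).domRestrict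
  let H : C(unitInterval × polarPreimage Ψ E, ({0}ᶜ : Set (ℝ × ℝ))) :=
    ⟨fun q => ⟨φ (T * q.1) (Ψ q.2), hnull _ (hmul q.1) _ q.2.2.2⟩,
      Continuous.subtype_mk (hφ.continuousOn.comp_continuous
        (f := fun q : unitInterval × polarPreimage Ψ E => (T * (q.1 : ℝ), Ψ q.2))
        ((by fun_prop : Continuous fun q : unitInterval × polarPreimage Ψ E =>
          T * (q.1 : ℝ)).prodMk (hΨc.comp continuous_snd)) hpair) _⟩
  let f : C(polarPreimage Ψ E, openHalfPlane) := ⟨fun y => ⟨y, hsub y.2⟩, by fun_prop⟩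
  have h0 : ∀ y, H (0, y) = (⟨Ψ (f y), hΨ.apply_ne_zero (f y).2⟩ : ({0}ᶜ : Set (ℝ × ℝ))) :=
    fun y => Subtype.ext (by
      change φ (T * ((0 : unitInterval) : ℝ)) (Ψ y) = Ψ y
      simpa using hφ.initial _ y.2.2)
  let G := hΨ.isCoveringMap.liftHomotopy H f h0
  have hG : ∀ q, Ψ (G q) = φ (T * q.1) (Ψ q.2) := fun q =>
    congrArg Subtype.val (congrFun (hΨ.isCoveringMap.liftHomotopy_lifts H f h0) q)
  have hG0 : ∀ y, G (0, y) = f y := hΨ.isCoveringMap.liftHomotopy_zero H f h0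
  let Φ : ℝ → ℝ × ℝ → ℝ × ℝ := fun t y =>
    if hy : y ∈ polarPreimage Ψ E then G (projIcc 0 1 zero_le_one (t / T), ⟨y, hy⟩) else y
  have hΦ : ∀ t (y : ℝ × ℝ) (hy : y ∈ polarPreimage Ψ E),
      Φ t y = G (projIcc 0 1 zero_le_one (t / T), ⟨y, hy⟩) := fun t y hy => dif_pos hy
  have hproj : ∀ t ∈ Icc 0 T, T * (projIcc (0 : ℝ) 1 zero_le_one (t / T) : ℝ) = t := fun t ht => by
    rw [projIcc_of_mem _ ⟨div_nonneg ht.1 hT.le, (div_le_one hT).2 ht.2⟩]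
    exact mul_div_cancel₀ t hT.ne'
  refine ⟨Φ, ⟨?_, fun t _ y hy => ?_, fun y hy => ?_, fun t ht y hy => ?_⟩⟩
  · rw [continuousOn_iff_continuous_domRestrict]
    have : (Icc 0 T ×ˢ polarPreimage Ψ E).domRestrict (uncurry Φ) = fun q =>
        (G (projIcc 0 1 zero_le_one (q.1.1 / T), ⟨q.1.2, q.2.2⟩) : ℝ × ℝ) := by
      funext q
      exact hΦ _ _ q.2.2
    rw [this]
    refine continuous_subtype_val.comp (G.continuous.comp (Continuous.prodMk ?_ ?_))
    · exact continuous_projIcc.comp (by fun_prop)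
    · exact Continuous.subtype_mk (by fun_prop) _
  · rw [hΦ t y hy]
    exact Subtype.prop _
  · rw [hΦ 0 y hy, zero_div, projIcc_left]
    exact congrArg Subtype.val (hG0 ⟨y, hy⟩)
  · rw [hΦ t y hy, hG, hproj t ht]

/-- Lifts commute with the deck transformations. -/
theorem IsPolarLift.apply_add {Ψ : ℝ × ℝ → ℝ × ℝ} (hΨ : IsPolarLike Ψ) {T : ℝ}
    {E : Set (ℝ × ℝ)} {φ Φ : ℝ → ℝ × ℝ → ℝ × ℝ} (hΦ : IsPolarLift Ψ T E φ Φ) {y : ℝ × ℝ}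
    (hy : y ∈ polarPreimage Ψ E) (n : ℤ) {t : ℝ} (ht : t ∈ Icc 0 T) :
    Φ t (y + (2 * Real.pi * n, 0)) = Φ t y + (2 * Real.pi * n, 0) := by
  have hyn : Ψ (y + (2 * Real.pi * n, 0)) = Ψ y := by
    have := hΨ.apply_add_two_pi_mul_int hy.1 y.1 n
    rw [← this]; congr 1; ext <;> simp
  have hy' : y + (2 * Real.pi * n, 0) ∈ polarPreimage Ψ E :=
    ⟨by simpa [closedHalfPlane] using hy.1, by rw [hyn]; exact hy.2⟩
  have hint : ∀ s ∈ Icc 0 T, ∃ m : ℤ,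
      Φ s (y + (2 * Real.pi * n, 0)) = Φ s y + (2 * Real.pi * m, 0) := fun s hs =>
    hΨ.eq_add_of_apply_eq (hΦ.mapsTo s hs y hy) (hΦ.mapsTo s hs _ hy')
      (by rw [hΦ.lifts s hs _ hy', hΦ.lifts s hs y hy, hyn])
  have hcont : ∀ z ∈ polarPreimage Ψ E, ContinuousOn (fun s => Φ s z) (Icc 0 T) := fun z hz =>
    hΦ.continuousOn.comp (f := fun s => (s, z)) (by fun_prop) fun s hs => ⟨hs, hz⟩
  have hdisc : IsDiscrete (range ((↑) : ℤ → ℝ)) :=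
    ⟨Int.isClosedEmbedding_coe_real.isEmbedding.toHomeomorph.symm.isEmbedding.discreteTopology⟩
  -- The two lifted trajectories differ by an integer number of turns that is continuous in time,
  -- hence equal to its value `n` at time zero.
  have hconst := isPreconnected_Icc.constant_of_mapsTo (S := Icc 0 T) hdisc (T := range ((↑) : ℤ → ℝ))
    (f := fun s => ((Φ s (y + (2 * Real.pi * n, 0))).1 - (Φ s y).1) / (2 * Real.pi))
    ((((hcont _ hy').fst).sub (hcont y hy).fst).div_const _) (by
      intro s hs
      obtain ⟨m, hm⟩ := hint s hs
      exact ⟨m, by simp [hm, Real.pi_ne_zero]⟩)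
    ht (y := 0) ⟨le_rfl, ht.1.trans ht.2⟩
  obtain ⟨m, hm⟩ := hint t ht
  rw [hm]
  simp only [hm, hΦ.initial _ hy', hΦ.initial y hy, Prod.fst_add, add_sub_cancel_left] at hconst
  rw [div_left_inj' Real.two_pi_pos.ne'] at hconst
  rw [hconst]

/-! ### Extending the boundary displacement -/

theorem exists_continuous_forall_mem_eqOn {s : Set (ℝ × ℝ)} (hs : IsClosed s) {f : ℝ × ℝ → ℝ}
    (hf : ContinuousOn f s) {t : Set ℝ} [OrdConnected t] (hft : MapsTo f s t) (ht : t.Nonempty) :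
    ∃ g : ℝ × ℝ → ℝ, Continuous g ∧ (∀ x, g x ∈ t) ∧ EqOn g f s := by
  obtain ⟨g, hg, hgf⟩ := ContinuousMap.exists_extension_forall_mem_of_isClosedEmbedding
    (⟨_, hf.domRestrict⟩ : C(s, ℝ)) (t := t) (fun x => hft x.2) ht hs.isClosedEmbedding_subtypeVal
  exact ⟨g, g.continuous, hg, fun x hx => congrFun hgf ⟨x, hx⟩⟩

/-- Truncation of a rotation function `u`: if the ranges of `u` on `D` and on `E` have no integer in
common in their convex hulls, then `u` can be changed off `D` in such a way that it takes no new
integer values and that its values on `E` lie strictly between two consecutive integers. -/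
theorem exists_truncation {A D E : Set (ℝ × ℝ)} {u : ℝ × ℝ → ℝ} (hu : ContinuousOn u A)
    (hD : IsCompact D) (hDn : D.Nonempty) (hDA : D ⊆ A) (hE : E.Nonempty)
    (hdisj : ∀ i : ℤ, (i : ℝ) ∈ convexHull ℝ (u '' D) → (i : ℝ) ∉ convexHull ℝ (u '' E)) :
    ∃ c : ℝ × ℝ → ℝ, ContinuousOn c A ∧ EqOn c u D ∧
      (∃ k : ℤ, MapsTo c E (Ioo (k : ℝ) (k + 1))) ∧
      ∀ x, ∀ i : ℤ, c x = i → u x = i ∧ (i : ℝ) ∈ convexHull ℝ (u '' D) := by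
  obtain ⟨xα, hxα, hα⟩ := hD.exists_isMinOn hDn (hu.mono hDA)
  obtain ⟨xβ, hxβ, hβ⟩ := hD.exists_isMaxOn hDn (hu.mono hDA)
  set α := u xα
  set β := u xβ
  have hle : ∀ x ∈ D, α ≤ u x ∧ u x ≤ β := fun x hx => ⟨hα hx, hβ hx⟩
  have hhull : ∀ {s : Set (ℝ × ℝ)} {x y : ℝ × ℝ} {z : ℝ}, x ∈ s → y ∈ s → u x ≤ z → z ≤ u y →
      z ∈ convexHull ℝ (u '' s) := fun hx hy h1 h2 =>
    (convex_convexHull ℝ _).ordConnected.out (subset_convexHull ℝ _ (mem_image_of_mem u hx))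
      (subset_convexHull ℝ _ (mem_image_of_mem u hy)) ⟨h1, h2⟩
  -- The midpoint between `α` and the largest integer strictly below it; `b` is symmetric. Thus `a`
  -- and `b` are not integers, even if `α` or `β` is, and `[a, b]` has the same integers as `[α,
  -- β]`.
  set a : ℝ := (⌈α⌉ - 1 + α) / 2 with ha
  set b : ℝ := (⌊β⌋ + 1 + β) / 2 with hb
  have hα1 := Int.le_ceil α
  have hα2 := Int.ceil_lt_add_one α
  have hβ1 := Int.floor_le β
  have hβ2 := Int.lt_floor_add_one β
  have hαβ : α ≤ β := (hle xα hxα).2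
  have haα : a ≤ α := by linarith
  have hβb : β ≤ b := by linarith
  have hint : ∀ i : ℤ, a ≤ i → i ≤ b →
      a < i ∧ i < b ∧ (i : ℝ) ∈ convexHull ℝ (u '' D) := by
    intro i h1 h2
    have h3 : ⌈α⌉ ≤ i := by
      have : ((⌈α⌉ - 1 : ℤ) : ℝ) < i := by push_cast; linarith
      have : ⌈α⌉ - 1 < i := by exact_mod_cast this
      omega
    have h4 : i ≤ ⌊β⌋ := by
      have : (i : ℝ) < ((⌊β⌋ + 1 : ℤ) : ℝ) := by push_cast; linarith
      have : i < ⌊β⌋ + 1 := by exact_mod_cast this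
      omega
    have h3' : (⌈α⌉ : ℝ) ≤ i := by exact_mod_cast h3
    have h4' : (i : ℝ) ≤ ⌊β⌋ := by exact_mod_cast h4
    exact ⟨by linarith, by linarith, hhull hxα hxβ (by linarith) (by linarith)⟩
  set c : ℝ × ℝ → ℝ := fun x => max a (min b (u x)) with hc
  have hca : ∀ x, a ≤ c x := fun x => le_max_left _ _
  have hcb : ∀ x, c x ≤ b := fun x => max_le (haα.trans (hαβ.trans hβb)) (min_le_left _ _)
  have hle_of : ∀ x z, z < b → c x ≤ z → u x ≤ z := fun x z hz h => by
    rcases min_le_iff.1 ((le_max_right _ _).trans h) with h | h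
    · exact absurd hz (not_lt.2 h)
    · exact h
  have hge_of : ∀ x z, a < z → z ≤ c x → z ≤ u x := fun x z hz h => by
    rcases le_max_iff.1 h with h | h
    · exact absurd hz (not_lt.2 h)
    · exact h.trans (min_le_right _ _)
  have hcint : ∀ x, ∀ i : ℤ, c x = i → u x = i ∧ (i : ℝ) ∈ convexHull ℝ (u '' D) := by
    intro x i hi
    obtain ⟨h1, h2, h3⟩ := hint i (hi ▸ hca x) (hi ▸ hcb x)
    exact ⟨le_antisymm (hle_of x i h2 hi.le) (hge_of x i h1 hi.ge), h3⟩
  refine ⟨c, continuousOn_const.sup (continuousOn_const.inf hu), fun x hx => ?_, ?_, hcint⟩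
  · obtain ⟨h1, h2⟩ := hle x hx
    simp only [hc]
    rw [min_eq_right (h2.trans hβb), max_eq_right (haα.trans h1)]
  -- An integer between two values of `c` on `E` lies strictly inside `[a, b]`, hence also between
  -- the two values of `u`: it would be in both convex hulls.
  · have hcross : ∀ i : ℤ, ∀ x ∈ E, ∀ y ∈ E, c x ≤ i → ¬ (i : ℝ) ≤ c y := by
      intro i x hx y hy h1 h2
      obtain ⟨h3, h4, h5⟩ := hint i ((hca x).trans h1) (h2.trans (hcb y))
      exact hdisj i h5 (hhull hx hy (hle_of x i h4 h1) (hge_of y i h3 h2))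
    obtain ⟨x₀, hx₀⟩ := hE
    refine ⟨⌊c x₀⌋, fun x hx => ⟨?_, ?_⟩⟩
    · by_contra h
      exact hcross _ x hx x₀ hx₀ (not_lt.1 h) (Int.floor_le _)
    · by_contra h
      refine hcross (⌊c x₀⌋ + 1) x₀ hx₀ x hx ?_ ?_
      · push_cast; exact (Int.lt_floor_add_one _).le
      · push_cast; exact not_lt.1 h

/-- Let `L` be the lift to polar-like coordinates of a map on the closed set `A` of the punctured
plane. If the twist condition holds between `D ⊆ A` and `A ∩ B`, and no fixed point has a rotation
number in the convex hull of the rotations on `D`, then the displacement on `D` extends to `A ∪ B`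
without zeros off the origin, with value `-x` on `Z`. -/
theorem exists_displacement_extension {Ψ : ℝ × ℝ → ℝ × ℝ} (hΨ : IsPolarLike Ψ)
    {A B D Z : Set (ℝ × ℝ)} (hA : IsClosed A) (hB : IsClosed B) (hA0 : (0 : ℝ × ℝ) ∉ A)
    (hD : IsCompact D) (hDn : D.Nonempty) (hDA : D ⊆ A) (hAB : (A ∩ B).Nonempty)
    (hZ : IsClosed Z) (hAZ : Disjoint A Z) (hZ0 : (0 : ℝ × ℝ) ∈ B → Z ∈ 𝓝 0)
    {L : ℝ × ℝ → ℝ × ℝ} (hLc : ContinuousOn L (polarPreimage Ψ A))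
    (hLH : MapsTo L (polarPreimage Ψ A) openHalfPlane)
    (hLadd : ∀ y ∈ polarPreimage Ψ A, ∀ n : ℤ,
      L (y + (2 * Real.pi * n, 0)) = L y + (2 * Real.pi * n, 0))
    (hdisj : ∀ i : ℤ, i ∈ rotationIntegers Ψ (fun y => L y - y) D →
      i ∉ rotationIntegers Ψ (fun y => L y - y) (A ∩ B))
    (hfix : ∀ y ∈ polarPreimage Ψ A, ∀ i : ℤ, i ∈ rotationIntegers Ψ (fun y => L y - y) D →
      L y ≠ y + (2 * Real.pi * i, 0)) :
    ∃ F : ℝ × ℝ → ℝ × ℝ, ContinuousOn F (A ∪ B) ∧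
      (∀ y ∈ polarPreimage Ψ D, F (Ψ y) = Ψ (L y) - Ψ y) ∧
      (∀ x ∈ A ∪ B, x ≠ 0 → F x ≠ 0) ∧ ∀ x ∈ Z, F x = -x := by
  classical
  have hsec : ∀ x : ℝ × ℝ, ∃ y : ℝ × ℝ, x ≠ 0 → y ∈ openHalfPlane ∧ Ψ y = x := fun x => by
    by_cases hx : x = 0
    · exact ⟨0, fun h => absurd hx h⟩
    · obtain ⟨y, hy⟩ := hΨ.exists_apply_eq hx
      exact ⟨y, fun _ => hy⟩
  -- An arbitrary, possibly discontinuous section of `Ψ`. Only expressions invariant under the deck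
  -- transformations are formed from it, and these are continuous by `continuousOn_of_comp`.
  choose σ hσ using hsec
  have hσn : ∀ y ∈ openHalfPlane, ∃ n : ℤ, σ (Ψ y) = y + (2 * Real.pi * n, 0) := fun y hy =>
    hΨ.eq_add_of_apply_eq hy (hσ _ (hΨ.apply_ne_zero hy)).1 (hσ _ (hΨ.apply_ne_zero hy)).2
  have hpre : ∀ {S : Set (ℝ × ℝ)}, ∀ x ∈ S, x ≠ 0 → σ x ∈ polarPreimage Ψ S := fun x hx h0 =>
    ⟨openHalfPlane_subset_closedHalfPlane (hσ x h0).1, by rw [(hσ x h0).2]; exact hx⟩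
  have hA0' : ∀ x ∈ A, x ≠ 0 := fun x hx h => hA0 (h ▸ hx)
  have hsub := hΨ.polarPreimage_subset hA0
  set u : ℝ × ℝ → ℝ := fun x => 1 / (2 * Real.pi) * (L (σ x) - σ x).1 with hu
  have huΨ : ∀ y ∈ polarPreimage Ψ A, u (Ψ y) = 1 / (2 * Real.pi) * (L y - y).1 := fun y hy => by
    obtain ⟨n, hn⟩ := hσn y (hsub hy)
    simp only [hu, hn, hLadd y hy n, add_sub_add_right_eq_sub]
  have huc : ContinuousOn u A := hΨ.continuousOn_of_comp hA0
    (continuousOn_const.mul (hLc.sub continuousOn_id).fst) huΨ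
  have hrot : ∀ S ⊆ A, rotationSet Ψ (fun y => L y - y) S = u '' S := fun S hS => by
    ext z
    constructor
    · rintro ⟨y, hy, rfl⟩
      exact ⟨Ψ y, hy.2, huΨ y ⟨hy.1, hS hy.2⟩⟩
    · rintro ⟨x, hx, rfl⟩
      exact ⟨σ x, hpre x hx (hA0' x (hS hx)), rfl⟩
  have hρc : ContinuousOn (fun x => (L (σ x)).2) A := hΨ.continuousOn_of_comp hA0 hLc.snd
    fun y hy => by
      obtain ⟨n, hn⟩ := hσn y (hsub hy)
      simp [hn, hLadd y hy n]
  -- The radial component of `L`, extended to the plane with positive values.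
  obtain ⟨R, hRc, hRpos, hRL⟩ := exists_continuous_forall_mem_eqOn hA hρc (t := Ioi 0)
    (fun x hx => hLH (hpre x hx (hA0' x hx))) ⟨1, mem_Ioi.2 one_pos⟩
  obtain ⟨χ, hχZ, hχA, hχ01⟩ := exists_continuous_zero_one_of_isClosed hZ hA hAZ.symm
  obtain ⟨c₁, hc₁, hc₁u, ⟨k, hk⟩, hc₁int⟩ := exists_truncation huc hD hDn hDA hAB (by
    intro i hi h
    refine hdisj i ?_ ?_
    · change (i : ℝ) ∈ convexHull ℝ (rotationSet Ψ (fun y => L y - y) D)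
      rwa [hrot D hDA]
    · change (i : ℝ) ∈ convexHull ℝ (rotationSet Ψ (fun y => L y - y) (A ∩ B))
      rwa [hrot _ inter_subset_left])
  -- The truncated rotation is continued over `B` inside an integer-free gap, so no zeros arise
  -- there.
  obtain ⟨c₂, hc₂, hc₂k, hc₂c₁⟩ := exists_continuous_forall_mem_eqOn (hA.inter hB)
    (hc₁.mono inter_subset_left) (t := Ioo (k : ℝ) (k + 1)) hk ⟨k + 1 / 2, by constructor <;> linarith⟩
  set c : ℝ × ℝ → ℝ := fun x => if x ∈ A then c₁ x else c₂ x with hcdef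
  have hcA : ∀ x ∈ A, c x = c₁ x := fun x hx => if_pos hx
  have hcB : ∀ x ∈ B, c x = c₂ x := fun x hx => by
    by_cases h : x ∈ A
    · rw [hcA x h, hc₂c₁ ⟨h, hx⟩]
    · exact if_neg h
  have hcc : ContinuousOn c (A ∪ B) :=
    (hc₁.congr hcA).union_of_isClosed (hc₂.continuousOn.congr hcB) hA hB
  set F : ℝ × ℝ → ℝ × ℝ := fun x => Ψ ((σ x).1 + 2 * Real.pi * c x, R x * χ x) - x with hF
  have hnonneg : ∀ x, 0 ≤ R x * χ x := fun x => mul_nonneg (le_of_lt (hRpos x)) (hχ01 x).1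
  have hFZ : ∀ x ∈ Z, F x = -x := fun x hx => by
    have : Ψ ((σ x).1 + 2 * Real.pi * c x, R x * χ x) = 0 := by
      rw [hΨ.origin _ (hnonneg x)]
      simp [hχZ hx]
    simp [hF, this]
  have hFc : ContinuousOn F ((A ∪ B) \ {0}) := by
    refine ContinuousOn.sub ?_ continuousOn_id
    refine hΨ.continuousOn_of_comp (fun h => h.2 rfl)
      (W := fun y => Ψ (y.1 + 2 * Real.pi * c (Ψ y), R (Ψ y) * χ (Ψ y))) ?_ ?_
    · have hΨc : ContinuousOn Ψ (polarPreimage Ψ ((A ∪ B) \ {0})) :=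
        hΨ.continuousOn.mono fun y hy => hy.1
      refine hΨ.continuousOn.comp (ContinuousOn.prodMk ?_ ?_) fun y _ => hnonneg (Ψ y)
      · exact continuousOn_fst.add (continuousOn_const.mul
          (hcc.comp hΨc fun y hy => hy.2.1))
      · exact (hRc.comp_continuousOn hΨc).mul (χ.continuous.comp_continuousOn hΨc)
    · intro y hy
      obtain ⟨n, hn⟩ := hσn y (hΨ.polarPreimage_subset (fun h => h.2 rfl) hy)
      rw [hn, ← hΨ.apply_add_two_pi_mul_int (hnonneg (Ψ y))
        (y.1 + 2 * Real.pi * c (Ψ y)) n]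
      congr 2
      simp only [Prod.fst_add]
      ring
  refine ⟨F, fun x hx => ?_, fun y hy => ?_, fun x hx hx0 h0 => ?_, hFZ⟩
  · by_cases hx0 : x = 0
    · subst hx0
      have hZn := hZ0 (hx.resolve_left hA0)
      have : ContinuousAt F 0 := continuousAt_neg.congr
        (by filter_upwards [hZn] with y hy using (hFZ y hy).symm)
      exact this.continuousWithinAt
    · have h1 := hFc x ⟨hx, hx0⟩
      rw [ContinuousWithinAt, sdiff_eq, nhdsWithin_inter_of_mem'
        (mem_nhdsWithin_of_mem_nhds (isOpen_compl_singleton.mem_nhds hx0))] at h1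
      exact h1
  · have hyA : y ∈ polarPreimage Ψ A := ⟨hy.1, hDA hy.2⟩
    obtain ⟨n, hn⟩ := hσn y (hsub hyA)
    have h1 : R (Ψ y) * χ (Ψ y) = (L y).2 := by
      rw [hRL hyA.2, hχA hyA.2]
      simp [hn, hLadd y hyA n]
    have h2 : 2 * Real.pi * c (Ψ y) = (L y - y).1 := by
      rw [hcA _ hyA.2, hc₁u hy.2, huΨ y hyA]
      field_simp
    simp only [hF, h1, h2, hn]
    rw [← hΨ.apply_add_two_pi_mul_int (le_of_lt (hLH hyA)) (L y).1 n]
    congr 3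
    simp only [Prod.fst_add, Prod.fst_sub]
    ring
  · obtain ⟨hσH, hσx⟩ := hσ x hx0
    have h1 : Ψ ((σ x).1 + 2 * Real.pi * c x, R x * χ x) = Ψ (σ x) := by
      rw [hσx]; exact sub_eq_zero.1 h0
    -- The cutoff radius cannot vanish at a zero of `F`, since `Ψ` would then give the origin
    -- instead of `x`.
    have hpos : ((σ x).1 + 2 * Real.pi * c x, R x * χ x) ∈ openHalfPlane := by
      refine lt_of_le_of_ne (hnonneg x) fun h => ?_
      have := (hΨ.origin ((σ x).1 + 2 * Real.pi * c x, R x * χ x) (hnonneg x)).2 h.symm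
      exact hΨ.apply_ne_zero hσH (h1 ▸ this)
    obtain ⟨i, hi⟩ := hΨ.eq_add_of_apply_eq hσH hpos h1
    have hi1 : c x = i := by
      have := congrArg Prod.fst hi
      simp only [Prod.fst_add] at this
      exact mul_left_cancel₀ Real.two_pi_pos.ne' (add_left_cancel this)
    have hi2 : R x * χ x = (σ x).2 := by simpa using congrArg Prod.snd hi
    -- On `A` the truncation creates no integer values and `χ = 1`, so the zero is an excluded fixed
    -- point. On `B` the integer `i` would lie in the gap.
    by_cases hxA : x ∈ A
    · obtain ⟨hui, hihull⟩ := hc₁int x i ((hcA x hxA).symm.trans hi1)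
      refine hfix (σ x) (hpre x hxA hx0) i ?_ (Prod.ext ?_ ?_)
      · change (i : ℝ) ∈ convexHull ℝ (rotationSet Ψ (fun y => L y - y) D)
        rwa [hrot D hDA]
      · simp only [hu, Prod.fst_sub] at hui
        field_simp at hui
        simp only [Prod.fst_add]
        linarith
      · rw [hRL hxA, hχA hxA] at hi2
        simpa using hi2
    · have hxB := hx.resolve_left hxA
      have h3 := hc₂k x
      rw [← hcB x hxB, hi1] at h3
      have h4 : k < i := by exact_mod_cast h3.1
      have h5 : i < k + 1 := by exact_mod_cast h3.2
      omega

/-! ### The fixed point theorem -/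

theorem frontier_nonempty_of_isBounded {U : Set (ℝ × ℝ)} (hb : Bornology.IsBounded U)
    (hne : U.Nonempty) : (frontier U).Nonempty :=
  nonempty_frontier_iff.2 ⟨hne, fun h => NormedSpace.unbounded_univ ℝ (ℝ × ℝ) (h ▸ hb)⟩

theorem mainTheorem1
    (Ψ : ℝ × ℝ → ℝ × ℝ) (hΨ : IsPolarLike Ψ)
    (Uin Uout : Set (ℝ × ℝ)) (hA : IsAnnulusPair Uin Uout)
    (T : ℝ) (hT : 0 < T)
    (φ : ℝ → ℝ × ℝ → ℝ × ℝ) (hφ : IsEvolutionMap T (genAnnulus Uin Uout) φ)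
    (hnull : nullSet T (genAnnulus Uin Uout) φ ∩ genAnnulus Uin Uout = ∅)
    (htwist :
      rotationIntegers Ψ (polarDisplacement Ψ T (genAnnulus Uin Uout) φ) (frontier Uout) ∩
        rotationIntegers Ψ (polarDisplacement Ψ T (genAnnulus Uin Uout) φ) (frontier Uin) = ∅) :
    ((0 : ℝ × ℝ) ∉ displacement T φ '' frontier Uin →
      brouwerDegree (displacement T φ) Uin 0 ≠ 1 →
      ∃ x ∈ genAnnulus Uin Uout, φ T x = x ∧
        ∃ i ∈ rotationIntegers Ψ (polarDisplacement Ψ T (genAnnulus Uin Uout) φ) (frontier Uin),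
          HasIntegerRotation Ψ (polarDisplacement Ψ T (genAnnulus Uin Uout) φ) x i) ∧
    ((0 : ℝ × ℝ) ∉ displacement T φ '' frontier Uout →
      brouwerDegree (displacement T φ) Uout 0 ≠ 1 →
      ∃ x ∈ genAnnulus Uin Uout, φ T x = x ∧
        ∃ i ∈ rotationIntegers Ψ (polarDisplacement Ψ T (genAnnulus Uin Uout) φ) (frontier Uout),
          HasIntegerRotation Ψ (polarDisplacement Ψ T (genAnnulus Uin Uout) φ) x i) := by
  have hex := exists_isPolarLift hΨ hT hφ fun t ht x hx h =>
    (hnull.le ⟨⟨hx, t, ht, h⟩, hx⟩ : x ∈ (∅ : Set (ℝ × ℝ)))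
  have hlift : IsPolarLift Ψ T (genAnnulus Uin Uout) φ (polarLift Ψ T (genAnnulus Uin Uout) φ) := by
    rw [polarLift, dif_pos hex]
    exact hex.choose_spec
  set A := genAnnulus Uin Uout with hAdef
  set L := polarLift Ψ T A φ T with hL
  have hF : polarDisplacement Ψ T A φ = fun y => L y - y := rfl
  rw [hF] at htwist ⊢
  have hTm : T ∈ Icc 0 T := ⟨hT.le, le_rfl⟩
  have hAcl : IsClosed A := isClosed_closure.sdiff hA.isOpen_in
  have hA0 : (0 : ℝ × ℝ) ∉ A := fun h => h.2 hA.zero_mem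
  have hLc : ContinuousOn L (polarPreimage Ψ A) :=
    hlift.continuousOn.comp (f := fun y => (T, y)) (by fun_prop) fun y hy => ⟨hTm, hy⟩
  have hLH : MapsTo L (polarPreimage Ψ A) openHalfPlane := hlift.mapsTo T hTm
  have hLadd : ∀ y ∈ polarPreimage Ψ A, ∀ n : ℤ,
      L (y + (2 * Real.pi * n, 0)) = L y + (2 * Real.pi * n, 0) := fun y hy n =>
    hlift.apply_add hΨ hy n hTm
  have hLφ : ∀ y ∈ polarPreimage Ψ A, Ψ (L y) = φ T (Ψ y) := hlift.lifts T hTm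
  have hin_out : Uin ⊆ Uout := subset_closure.trans hA.closure_subset
  have hfin : frontier Uin ⊆ A := fun x hx => by
    rw [hA.isOpen_in.frontier_eq] at hx
    exact ⟨subset_closure (hA.closure_subset hx.1), hx.2⟩
  have hfout : frontier Uout ⊆ A := fun x hx => by
    rw [hA.isOpen_out.frontier_eq] at hx
    exact ⟨hx.1, fun h => hx.2 (hin_out h)⟩
  have hcpt : ∀ {U : Set (ℝ × ℝ)}, Bornology.IsBounded U → IsCompact (frontier U) := fun hb =>
    Metric.isCompact_of_isClosed_isBounded isClosed_frontier
      (hb.closure.subset frontier_subset_closure)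
  have hnin := frontier_nonempty_of_isBounded hA.isBounded_in ⟨0, hA.zero_mem⟩
  have hnout := frontier_nonempty_of_isBounded hA.isBounded_out ⟨0, hin_out hA.zero_mem⟩
  have hdc : ContinuousOn (displacement T φ) A :=
    (hφ.continuousOn.comp (f := fun x => (T, x)) (by fun_prop) fun x hx => ⟨hTm, hx⟩).sub
      continuousOn_id
  have hfixed : ∀ D : Set (ℝ × ℝ), (¬ ∃ x ∈ A, φ T x = x ∧
      ∃ i ∈ rotationIntegers Ψ (fun y => L y - y) D,
        HasIntegerRotation Ψ (fun y => L y - y) x i) →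
      ∀ y ∈ polarPreimage Ψ A, ∀ i : ℤ, i ∈ rotationIntegers Ψ (fun y => L y - y) D →
        L y ≠ y + (2 * Real.pi * i, 0) := by
    intro D hno y hy i hi hLy
    have hyH := hΨ.polarPreimage_subset hA0 hy
    refine hno ⟨Ψ y, hy.2, ?_, i, hi, fun z hz => ?_⟩
    · rw [← hLφ y hy, hLy, ← hΨ.apply_add_two_pi_mul_int hy.1 y.1 i]
      congr 1
      ext <;> simp
    -- Equivariance of `L` transfers the rotation number from one point of the fibre to all of them.
    · have hzH := hΨ.polarPreimage_subset (fun h => hΨ.apply_ne_zero hyH h.symm) hz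
      obtain ⟨n, rfl⟩ := hΨ.eq_add_of_apply_eq hyH hzH hz.2
      simp [hLadd y hy n, hLy]
  have hext : ∀ {D : Set (ℝ × ℝ)} {F : ℝ × ℝ → ℝ × ℝ}, D ⊆ A →
      (∀ y ∈ polarPreimage Ψ D, F (Ψ y) = Ψ (L y) - Ψ y) → EqOn F (displacement T φ) D := by
    intro D F hDA h x hx
    obtain ⟨y, hy, rfl⟩ := hΨ.exists_apply_eq (x := x) fun h0 => hA0 (h0 ▸ hDA hx)
    have hyc := openHalfPlane_subset_closedHalfPlane hy
    rw [h y ⟨hyc, hx⟩, hLφ y ⟨hyc, hDA hx⟩]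
    rfl
  constructor
  · intro h0
    contrapose
    intro hno
    obtain ⟨N, hN⟩ := hA.isBounded_out.closure.subset_ball 0
    have hAB : A ∩ Uoutᶜ = frontier Uout := by
      rw [hA.isOpen_out.frontier_eq]
      ext x
      exact ⟨fun h => ⟨h.1.1, h.2⟩, fun h => ⟨⟨h.1, fun h' => h.2 (hin_out h')⟩, h.2⟩⟩
    have hunion : A ∪ Uoutᶜ = Uinᶜ := by
      ext x
      refine ⟨fun h => h.elim (fun h => h.2) fun h h' => h (hin_out h'), fun h => ?_⟩
      by_cases hx : x ∈ Uout
      · exact Or.inl ⟨subset_closure hx, h⟩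
      · exact Or.inr hx
    -- The extension goes outward, across the outer boundary to infinity; `Z` is the exterior of a
    -- ball containing `A`.
    obtain ⟨F, hFc, hFD, hF0, hFZ⟩ := exists_displacement_extension hΨ hAcl
      hA.isOpen_out.isClosed_compl hA0 (hcpt hA.isBounded_in) hnin hfin (hAB ▸ hnout)
      (Z := {x | N ≤ ‖x‖}) (isClosed_le continuous_const continuous_norm)
      (disjoint_left.2 fun x hx hxN => absurd (mem_ball_zero_iff.1 (hN hx.1)) (not_lt.2 hxN))
      (fun h => absurd (hin_out hA.zero_mem) h) hLc hLH hLadd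
      (fun i hi hi' => (htwist.le ⟨hAB ▸ hi', hi⟩ : i ∈ (∅ : Set ℤ)))
      (hfixed _ hno)
    rw [hunion] at hFc hF0
    exact brouwerDegree_eq_of_forall
      (exists_isBrouwerDegree hA.isBounded_in hnin (hdc.mono hfin) h0) fun d hd =>
      hd.eq_one_of_extension_compl hA.isOpen_in hA.isBounded_in hFc (hext hfin hFD)
        (fun x hx => hF0 x hx fun h => hx (h ▸ hA.zero_mem)) hFZ
  · intro h0
    contrapose
    intro hno
    obtain ⟨δ, hδ, hδU⟩ := Metric.nhds_basis_closedBall.mem_iff.1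
      (hA.isOpen_in.mem_nhds hA.zero_mem)
    have hAB : A ∩ closure Uin = frontier Uin := by
      rw [hA.isOpen_in.frontier_eq]
      ext x
      exact ⟨fun h => ⟨h.2, h.1.2⟩, fun h => ⟨⟨subset_closure (hA.closure_subset h.1), h.2⟩, h.1⟩⟩
    have hunion : A ∪ closure Uin = closure Uout := by
      ext x
      refine ⟨fun h => h.elim (fun h => h.1) fun h => subset_closure (hA.closure_subset h),
        fun h => ?_⟩
      by_cases hx : x ∈ Uin
      · exact Or.inr (subset_closure hx)
      · exact Or.inl ⟨h, hx⟩
    -- The extension goes inward, across the inner boundary to the origin; `Z` is a small ball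
    -- inside `Uin`.
    obtain ⟨F, hFc, hFD, hF0, hFZ⟩ := exists_displacement_extension hΨ hAcl
      isClosed_closure hA0 (hcpt hA.isBounded_out) hnout hfout (hAB ▸ hnin)
      (Z := Metric.closedBall 0 δ) Metric.isClosed_closedBall
      (disjoint_left.2 fun x hx hxδ => hx.2 (hδU hxδ))
      (fun _ => Metric.closedBall_mem_nhds 0 hδ) hLc hLH hLadd
      (fun i hi hi' => (htwist.le ⟨hi, hAB ▸ hi'⟩ : i ∈ (∅ : Set ℤ)))
      (hfixed _ hno)
    rw [hunion] at hFc hF0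
    exact brouwerDegree_eq_of_forall
      (exists_isBrouwerDegree hA.isBounded_out hnout (hdc.mono hfout) h0) fun d hd =>
      hd.eq_one_of_extension_closure hA.isOpen_out hA.isBounded_out hFc (hext hfout hFD)
        hF0 hδ (hδU.trans hin_out) fun x hx => hFZ x (mem_closedBall_zero_iff.2 hx)
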